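/- **Language.** Let $\mathcal X$ be a set of qubit variables (for instance a countably infinite one). Statements are given by $$S ::= \mathbf{skip}\mid \mathbf{new\ qbit}\ q\mid \mathbf{discard}\ q\mid q\mathrel{*}=U\mid S_0;S_1\mid \mathbf{meas}\ q\,(0\to S_0,1\to S_1)\mid \mathbf{while}\ q\ \mathbf{do}\ S\mid \mathbf{qcase}\ q\,(0\to S_0,1\to S_1)$$ with $q\in\mathcal X$ and $U$ a $2\times2$ unitary matrix; $\mathrm{Var}(S)$ is the set of variables occurring in $S$. Environments $\Gamma,\Delta$ are finite subsets of $\mathcal X$, and "$q,\Gamma$" means $\{q\}\cup\Gamma$ with $q\notin\Gamma$. A program $(\Gamma;S;\Delta)$ is one for which $\Gamma\vdash S\triangleright\Delta$ is derivable from the following rules: * $\Gamma\vdash\mathbf{skip}\triangleright\Gamma$; $\;\Gamma\vdash\mathbf{new\ qbit}\ q\triangleright q,\Gamma$; $\;q,\Gamma\vdash\mathbf{discard}\ q\triangleright\Gamma$; $\;q,\Gamma\vdash q\mathrel{*}=U\triangleright q,\Gamma$; * if $\Gamma\vdash S_0\triangleright\Gamma'$ and $\Gamma'\vdash S_1\triangleright\Gamma''$,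 then $\Gamma\vdash S_0;S_1\triangleright\Gamma''$; * if $q,\Gamma\vdash S_k\triangleright\Gamma'$ for $k=0,1$, then $q,\Gamma\vdash\mathbf{meas}\ q\,(0\to S_0,1\to S_1)\triangleright\Gamma'$; * if $q,\Gamma\vdash S\triangleright q,\Gamma$, then $q,\Gamma\vdash\mathbf{while}\ q\ \mathbf{do}\ S\triangleright q,\Gamma$; * if $\Gamma\vdash S_k\triangleright\Gamma'$ for $k=0,1$ and $q\notin\mathrm{Var}(S_0)\cup\mathrm{Var}(S_1)$, then $q,\Gamma\vdash\mathbf{qcase}\ q\,(0\to S_0,1\to S_1)\triangleright q,\Gamma'$. $\Delta$ is determined by $\Gamma$ and $S$. Let $\mathcal H_\Gamma\cong\mathbb C^{2^{|\Gamma|}}$ be the state space of the qubits named in $\Gamma$; a state is a vector of norm at most $1$. A subscript $q$ indicates action on the qubit $q$, tensored with the identity on the others. **Operational semantics.** Transitions $[S,|\psi\rangle]_\Gamma\to(|\psi'\rangle,\nu)$, where $\nu\in\{0,1\}$, are derived by the rules: * $[\mathbf{skip},\psi]\to(\psi,1)$; $\;[\mathbf{new\ qbit}\ q,\psi]\to(|0\rangle_q\otimes\psi,1)$;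 $\;[q\mathrel{*}=U,\psi]\to(U_q\psi,1)$; * $[\mathbf{discard}\ q,\psi]\to(\langle0|_q\psi,1)$ and $[\mathbf{discard}\ q,\psi]\to(\langle1|_q\psi,0)$; * if $[S_0,\psi]\to(\psi',\nu)$ and $[S_1,\psi']\to(\psi'',\mu)$, then $[S_0;S_1,\psi]\to(\psi'',\nu\mu)$; * for $S=\mathbf{meas}\ q\,(0\to S_0,1\to S_1)$: if $[S_0,|0\rangle\langle0|_q\psi]\to(\psi',\nu)$, then $[S,\psi]\to(\psi',\nu)$; if $[S_1,|1\rangle\langle1|_q\psi]\to(\psi',\nu)$, then $[S,\psi]\to(\psi',0)$; * for $W=\mathbf{while}\ q\ \mathbf{do}\ S$: $[W,\psi]\to(|0\rangle\langle0|_q\psi,1)$; and if $[S;W,|1\rangle\langle1|_q\psi]\to(\psi',\nu)$, then $[W,\psi]\to(\psi',0)$; * if $[S_k,\langle k|_q\psi]\to(\psi_k,\nu_k)$ for $k=0,1$, then $[\mathbf{qcase}\ q\,(0\to S_0,1\to S_1),\psi]\to(\nu_1|0\rangle_q\otimes\psi_0+\nu_0|1\rangle_q\otimes\psi_1,\ \nu_0\nu_1)$.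 The output ensemble $\mathscr E([S,\psi]_\Gamma)=\{(\psi_i',\nu_i)\}_i$ is the multiset of values $v\ne(0,0)$ with $[S,\psi]_\Gamma\to v$, the multiplicity of $v$ being the number of distinct derivations of $[S,\psi]_\Gamma\to v$. For $\psi\neq0$, the probability of termination is $p(S,\psi)_\Gamma=\sum_i\|\psi_i'\|^2/\|\psi\|^2$. **Denotational semantics.** A quantum operation is a completely positive, trace non-increasing linear map. For linear maps $\mathcal C:\mathcal L(\mathcal H_\Gamma)\to\mathcal L(\mathcal H_\Delta)$ and $F:\mathcal H_\Gamma\to\mathcal H_\Delta$, the map $\tilde{\mathcal C}^F:\mathcal L(\mathcal H_\Gamma\oplus\mathbb C)\to\mathcal L(\mathcal H_\Delta\oplus\mathbb C)$ is $$\tilde{\mathcal C}^F\begin{pmatrix}A&B\\ C&D\end{pmatrix}=\begin{pmatrix}\mathcal C(A)&FB\\ CF^\dagger&D\end{pmatrix}.$$ Let $\mathcal K_{\Gamma;\Delta}$ be the set of pairs $(\mathcal C,F)$ such that $\mathcal C$ and $\tilde{\mathcal C}^F$ are quantum operations, ordered by: $(\mathcal C,F)\le(\mathcal D,G)$ iff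 $\tilde{\mathcal D}^G-\tilde{\mathcal C}^F$ is completely positive. With $\mathcal P_k=|k\rangle\langle k|_q(\cdot)|k\rangle\langle k|_q$, put $$(\mathcal D,G)\circ(\mathcal C,F)=(\mathcal D\circ\mathcal C,GF),\qquad \overline{\mathrm{meas}}_q[(\mathcal C_0,F_0),(\mathcal C_1,F_1)]=(\mathcal C_0\circ\mathcal P_0+\mathcal C_1\circ\mathcal P_1,\ F_0|0\rangle\langle0|_q),$$ and, in block form with respect to the qubit $q$, $$\overline{\mathrm{qcase}}_q[(\mathcal C_0,F_0),(\mathcal C_1,F_1)]=\left(\begin{pmatrix}A&B\\C&D\end{pmatrix}\mapsto\begin{pmatrix}\mathcal C_0(A)&F_0BF_1^\dagger\\F_1CF_0^\dagger&\mathcal C_1(D)\end{pmatrix},\ \begin{pmatrix}F_0&0\\0&F_1\end{pmatrix}\right).$$ Then $[\![S]\!]_\Gamma$ is defined by recursion: $[\![\mathbf{skip}]\!]=(\mathcal I,I)$; $[\![\mathbf{new\ qbit}\ q]\!]=(|0\rangle\langle0|_q\otimes\mathcal I_\Gamma,|0\rangle_q\otimes I_\Gamma)$; $[\![\mathbf{discard}\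 q]\!]=(\mathrm{Tr}_q,\langle0|_q\otimes I)$; $[\![q\mathrel{*}=U]\!]=(U_q(\cdot)U_q^\dagger,U_q)$; $[\![S_0;S_1]\!]=[\![S_1]\!]\circ[\![S_0]\!]$; $[\![\mathbf{meas}\ q(\ldots)]\!]=\overline{\mathrm{meas}}_q[[\![S_0]\!],[\![S_1]\!]]$; $[\![\mathbf{qcase}\ q(\ldots)]\!]=\overline{\mathrm{qcase}}_q[[\![S_0]\!],[\![S_1]\!]]$; and $[\![\mathbf{while}\ q\ \mathbf{do}\ S]\!]$ is the least fixed point in $\mathcal K_{q,\Gamma;q,\Gamma}$ of $x\mapsto\overline{\mathrm{meas}}_q[(\mathcal I,I),\,x\circ[\![S]\!]]$. **Statement.** Let $(\Gamma;S;\Delta)$ be a program with $[\![S]\!]_\Gamma=(\mathcal C,F)$ and let $|\psi\rangle\in\mathcal H_\Gamma$ be a state with $0<\|\psi\|\le1$. Then every value $v\neq(0,0)$ has finitely many derivations from $[S,\psi]_\Gamma$, the family defining $p(S,\psi)_\Gamma$ is summable, and $$p(S,|\psi\rangle)_\Gamma=\frac{\mathrm{Tr}\bigl(\mathcal C(|\psi\rangle\langle\psi|)\bigr)}{\mathrm{Tr}(|\psi\rangle\langle\psi|)}.$$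 -/

import Mathlib

universe u

open scoped ComplexOrder

namespace QCtrl

/-! ### Syntax and well-formedness -/

/-- Statements of the language, over a set `X` of qubit variables. -/
inductive Stmt (X : Type u) : Type u
  | skip : Stmt X
  | newQbit (q : X) : Stmt X
  | discard (q : X) : Stmt X
  | gate (q : X) (U : Matrix.unitaryGroup (Fin 2) ℂ) : Stmt X
  | seq (S₀ S₁ : Stmt X) : Stmt X
  | meas (q : X) (S₀ S₁ : Stmt X) : Stmt X
  | whileDo (q : X) (S : Stmt X) : Stmt X
  | qcase (q : X) (S₀ S₁ : Stmt X) : Stmt X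

/-- The set of variables appearing in a statement. -/
def Stmt.vars {X : Type u} [DecidableEq X] : Stmt X → Finset X
  | .skip => ∅
  | .newQbit q => {q}
  | .discard q => {q}
  | .gate q _ => {q}
  | .seq S₀ S₁ => S₀.vars ∪ S₁.vars
  | .meas q S₀ S₁ => {q} ∪ (S₀.vars ∪ S₁.vars)
  | .whileDo q S => {q} ∪ S.vars
  | .qcase q S₀ S₁ => {q} ∪ (S₀.vars ∪ S₁.vars)

/-- `Typing Γ S Δ` is the type of derivations of the well-formedness judgment `Γ ⊢ S ▷ Δ`.
An input environment of the form `q, Γ'` (with `q ∉ Γ'`) is written as an environment `Γ` with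
`q ∈ Γ`, in which case `Γ' = Γ.erase q`. An output environment `q, Γ'` is `insert q Γ'` with
`q ∉ Γ'`. -/
inductive Typing {X : Type u} [DecidableEq X] : Finset X → Stmt X → Finset X → Type u
  | skip {Γ : Finset X} : Typing Γ .skip Γ
  | newQbit {Γ : Finset X} {q : X} (hq : q ∉ Γ) : Typing Γ (.newQbit q) (insert q Γ)
  | discard {Γ : Finset X} {q : X} (hq : q ∈ Γ) : Typing Γ (.discard q) (Γ.erase q)
  | gate {Γ : Finset X} {q : X} {U : Matrix.unitaryGroup (Fin 2) ℂ} (hq : q ∈ Γ) :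
      Typing Γ (.gate q U) Γ
  | seq {Γ Γ' Γ'' : Finset X} {S₀ S₁ : Stmt X} (d₀ : Typing Γ S₀ Γ') (d₁ : Typing Γ' S₁ Γ'') :
      Typing Γ (.seq S₀ S₁) Γ''
  | meas {Γ Γ' : Finset X} {q : X} {S₀ S₁ : Stmt X} (hq : q ∈ Γ)
      (d₀ : Typing Γ S₀ Γ') (d₁ : Typing Γ S₁ Γ') : Typing Γ (.meas q S₀ S₁) Γ'
  | whileDo {Γ : Finset X} {q : X} {S : Stmt X} (hq : q ∈ Γ) (d : Typing Γ S Γ) :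
      Typing Γ (.whileDo q S) Γ
  | qcase {Γ Γ' : Finset X} {q : X} {S₀ S₁ : Stmt X} (hq : q ∈ Γ) (hq' : q ∉ Γ')
      (hvar : q ∉ S₀.vars ∪ S₁.vars)
      (d₀ : Typing (Γ.erase q) S₀ Γ') (d₁ : Typing (Γ.erase q) S₁ Γ') :
      Typing Γ (.qcase q S₀ S₁) (insert q Γ')

/-- The output environment and the derivation are determined by `Γ` and `S`. -/
theorem Typing.heq {X : Type u} [DecidableEq X] {Γ Δ Δ' : Finset X} {S : Stmt X}
    (d : Typing Γ S Δ) (d' : Typing Γ S Δ') : Δ = Δ' ∧ HEq d d' := by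
  induction d generalizing Δ' with
  | skip => cases d'; exact ⟨rfl, HEq.rfl⟩
  | newQbit => cases d'; exact ⟨rfl, HEq.rfl⟩
  | discard => cases d'; exact ⟨rfl, HEq.rfl⟩
  | gate => cases d'; exact ⟨rfl, HEq.rfl⟩
  | seq _ _ h₀ h₁ =>
    cases d' with
    | seq e₀ e₁ =>
      obtain ⟨rfl, h₀⟩ := h₀ e₀
      obtain ⟨rfl, h₁⟩ := h₁ e₁
      cases h₀; cases h₁; exact ⟨rfl, HEq.rfl⟩
  | meas _ _ _ h₀ h₁ =>
    cases d' with
    | meas _ e₀ e₁ =>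
      obtain ⟨rfl, h₀⟩ := h₀ e₀
      cases h₀; cases (h₁ e₁).2; exact ⟨rfl, HEq.rfl⟩
  | whileDo _ _ h =>
    cases d' with
    | whileDo _ e => cases (h e).2; exact ⟨rfl, HEq.rfl⟩
  | qcase _ _ _ _ _ h₀ h₁ =>
    cases d' with
    | qcase _ _ _ e₀ e₁ =>
      obtain ⟨rfl, h₀⟩ := h₀ e₀
      cases h₀; cases (h₁ e₁).2; exact ⟨rfl, HEq.rfl⟩

/-- Derivations of well-formedness are unique. -/
instance {X : Type u} [DecidableEq X] {Γ Δ : Finset X} {S : Stmt X} :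
    Subsingleton (Typing Γ S Δ) :=
  ⟨fun d d' => eq_of_heq (d.heq d').2⟩

/-! ### Quantum states and elementary operators -/

/-- Labels of the computational basis of the qubits named in `Γ`: one bit per variable. -/
abbrev BasisIdx {X : Type u} (Γ : Finset X) : Type u := Γ → Fin 2

/-- The `2 ^ |Γ|`-dimensional Hilbert space of the qubits named in `Γ`. -/
abbrev Hilb {X : Type u} (Γ : Finset X) : Type u := EuclideanSpace ℂ (BasisIdx Γ)

/-- Linear maps between the state spaces of `Γ` and `Δ`, in the computational bases. -/
abbrev Op {X : Type u} (Γ Δ : Finset X) : Type u := Matrix (BasisIdx Δ) (BasisIdx Γ) ℂ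

/-- Application of an operator to a vector. -/
noncomputable def Op.act {X : Type u} [DecidableEq X] {Γ Δ : Finset X} (M : Op Γ Δ)
    (ψ : Hilb Γ) : Hilb Δ :=
  WithLp.toLp 2 (M.mulVec ψ.ofLp)

open Classical in
/-- The operator `|b⟩_q ⊗ I_Γ` from `Γ` to `Δ`, to be used when `q ∉ Γ` and `Δ = {q} ∪ Γ`. -/
noncomputable def ket {X : Type u} (q : X) (b : Fin 2) (Γ Δ : Finset X) : Op Γ Δ :=
  Matrix.of fun f g =>
    if (∀ h : q ∈ Δ, f ⟨q, h⟩ = b) ∧ (∀ x, ∀ h : x ∈ Δ, ∀ h' : x ∈ Γ, f ⟨x, h⟩ = g ⟨x, h'⟩)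
    then 1 else 0

/-- The operator `⟨b|_q ⊗ I_Γ` from `Δ` to `Γ`, to be used when `q ∉ Γ` and `Δ = {q} ∪ Γ`. -/
noncomputable def bra {X : Type u} (q : X) (b : Fin 2) (Δ Γ : Finset X) : Op Δ Γ :=
  (ket q b Γ Δ).conjTranspose

/-- The operator `|b⟩⟨b|_q` on `Γ ∋ q`. -/
noncomputable def proj {X : Type u} [DecidableEq X] (q : X) (b : Fin 2) (Γ : Finset X) : Op Γ Γ :=
  ket q b (Γ.erase q) Γ * bra q b Γ (Γ.erase q)

/-- The operator `U_q`: the gate `U` on the qubit `q ∈ Γ`, and the identity elsewhere. -/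
noncomputable def gateOp {X : Type u} [DecidableEq X] (q : X) (U : Matrix (Fin 2) (Fin 2) ℂ)
    (Γ : Finset X) : Op Γ Γ :=
  ∑ a : Fin 2, ∑ b : Fin 2, U a b • (ket q a (Γ.erase q) Γ * bra q b Γ (Γ.erase q))

/-! ### Operational semantics -/

/-- Values `(|ψ⟩, ν)`, with `|ψ⟩` in the state space of some environment. -/
structure Value (X : Type u) : Type u where
  env : Finset X
  state : Hilb env
  bit : Bool

/-- A bit, as the complex number `0` or `1`. -/
def bitC (ν : Bool) : ℂ := if ν then 1 else 0

/-- `Step Γ S ψ v` is the type of derivations of the big-step transition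
`[S, |ψ⟩]_Γ → v`. -/
inductive Step {X : Type u} [DecidableEq X] :
    (Γ : Finset X) → Stmt X → Hilb Γ → Value X → Type u
  | skip {Γ : Finset X} {ψ : Hilb Γ} : Step Γ .skip ψ ⟨Γ, ψ, true⟩
  | newQbit {Γ : Finset X} {q : X} {ψ : Hilb Γ} (hq : q ∉ Γ) :
      Step Γ (.newQbit q) ψ ⟨insert q Γ, (ket q 0 Γ (insert q Γ)).act ψ, true⟩
  | discard₀ {Γ : Finset X} {q : X} {ψ : Hilb Γ} (hq : q ∈ Γ) :
      Step Γ (.discard q) ψ ⟨Γ.erase q, (bra q 0 Γ (Γ.erase q)).act ψ, true⟩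
  | discard₁ {Γ : Finset X} {q : X} {ψ : Hilb Γ} (hq : q ∈ Γ) :
      Step Γ (.discard q) ψ ⟨Γ.erase q, (bra q 1 Γ (Γ.erase q)).act ψ, false⟩
  | gate {Γ : Finset X} {q : X} {U : Matrix.unitaryGroup (Fin 2) ℂ} {ψ : Hilb Γ} (hq : q ∈ Γ) :
      Step Γ (.gate q U) ψ ⟨Γ, (gateOp q U.1 Γ).act ψ, true⟩
  | seq {Γ Γ' Γ'' : Finset X} {S₀ S₁ : Stmt X} {ψ : Hilb Γ} {ψ' : Hilb Γ'} {ψ'' : Hilb Γ''}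
      {ν μ : Bool} (s₀ : Step Γ S₀ ψ ⟨Γ', ψ', ν⟩) (s₁ : Step Γ' S₁ ψ' ⟨Γ'', ψ'', μ⟩) :
      Step Γ (.seq S₀ S₁) ψ ⟨Γ'', ψ'', ν && μ⟩
  | meas₀ {Γ Γ' : Finset X} {q : X} {S₀ S₁ : Stmt X} {ψ : Hilb Γ} {ψ' : Hilb Γ'} {ν : Bool}
      (hq : q ∈ Γ) (s : Step Γ S₀ ((proj q 0 Γ).act ψ) ⟨Γ', ψ', ν⟩) :
      Step Γ (.meas q S₀ S₁) ψ ⟨Γ', ψ', ν⟩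
  | meas₁ {Γ Γ' : Finset X} {q : X} {S₀ S₁ : Stmt X} {ψ : Hilb Γ} {ψ' : Hilb Γ'} {ν : Bool}
      (hq : q ∈ Γ) (s : Step Γ S₁ ((proj q 1 Γ).act ψ) ⟨Γ', ψ', ν⟩) :
      Step Γ (.meas q S₀ S₁) ψ ⟨Γ', ψ', false⟩
  | whileDo₀ {Γ : Finset X} {q : X} {S : Stmt X} {ψ : Hilb Γ} (hq : q ∈ Γ) :
      Step Γ (.whileDo q S) ψ ⟨Γ, (proj q 0 Γ).act ψ, true⟩
  | whileDo₁ {Γ Γ' : Finset X} {q : X} {S : Stmt X} {ψ : Hilb Γ} {ψ' : Hilb Γ'} {ν : Bool}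
      (hq : q ∈ Γ) (s : Step Γ (.seq S (.whileDo q S)) ((proj q 1 Γ).act ψ) ⟨Γ', ψ', ν⟩) :
      Step Γ (.whileDo q S) ψ ⟨Γ', ψ', false⟩
  | qcase {Γ Γ' : Finset X} {q : X} {S₀ S₁ : Stmt X} {ψ : Hilb Γ} {ψ₀ ψ₁ : Hilb Γ'}
      {ν₀ ν₁ : Bool} (hq : q ∈ Γ)
      (s₀ : Step (Γ.erase q) S₀ ((bra q 0 Γ (Γ.erase q)).act ψ) ⟨Γ', ψ₀, ν₀⟩)
      (s₁ : Step (Γ.erase q) S₁ ((bra q 1 Γ (Γ.erase q)).act ψ) ⟨Γ', ψ₁, ν₁⟩) :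
      Step Γ (.qcase q S₀ S₁) ψ
        ⟨insert q Γ',
          bitC ν₁ • (ket q 0 Γ' (insert q Γ')).act ψ₀ + bitC ν₀ • (ket q 1 Γ' (insert q Γ')).act ψ₁,
          ν₀ && ν₁⟩

/-- The value `(0, 0)`, in any environment. -/
def Value.IsTrivial {X : Type u} (v : Value X) : Prop := v.state = 0 ∧ v.bit = false

open Classical in
/-- The output ensemble of the configuration `[S, |ψ⟩]_Γ`, as a multiplicity function on values:
the value `(0, 0)` is removed, any other value counts as often as it has derivations. -/
noncomputable def ensemble {X : Type u} [DecidableEq X] (Γ : Finset X) (S : Stmt X) (ψ : Hilb Γ)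
    (v : Value X) : ℕ :=
  if v.IsTrivial then 0 else Nat.card (Step Γ S ψ v)

/-- The probability of termination: the sum, over the elements `(|ψ'⟩, ν)` of the output
ensemble (with multiplicity), of `‖ψ'‖² / ‖ψ‖²`. -/
noncomputable def probTerm {X : Type u} [DecidableEq X] (Γ : Finset X) (S : Stmt X)
    (ψ : Hilb Γ) : ℝ :=
  ∑' v : Value X, (ensemble Γ S ψ v : ℝ) * (‖v.state‖ ^ 2 / ‖ψ‖ ^ 2)

/-! ### Quantum operations -/

/-- Linear maps from `L(ℂ^A)` to `L(ℂ^B)`. -/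
abbrev Superop (A B : Type u) : Type u := Matrix A A ℂ →ₗ[ℂ] Matrix B B ℂ

/-- The action of `C ⊗ id_E` on a matrix over `A × E`. -/
def tensorId {A B : Type u} (C : Superop A B) (E : Type) (ρ : Matrix (A × E) (A × E) ℂ) :
    Matrix (B × E) (B × E) ℂ :=
  Matrix.of fun x y => C (Matrix.of fun a a' => ρ (a, x.2) (a', y.2)) x.1 y.1

/-- Complete positivity. -/
def IsCP {A B : Type u} (C : Superop A B) : Prop :=
  ∀ (n : ℕ) (ρ : Matrix (A × Fin n) (A × Fin n) ℂ), ρ.PosSemidef → (tensorId C (Fin n) ρ).PosSemidef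

/-- Quantum operations: completely positive trace non-increasing maps. -/
def IsQO {A B : Type u} [Fintype A] [Fintype B] (C : Superop A B) : Prop :=
  IsCP C ∧ ∀ ρ : Matrix A A ℂ, ρ.PosSemidef → (C ρ).trace.re ≤ ρ.trace.re

/-- The map `ρ ↦ K ρ L†`. -/
def sandwich {A B : Type u} [Fintype A] (K L : Matrix B A ℂ) : Superop A B where
  toFun ρ := K * ρ * L.conjTranspose
  map_add' ρ σ := by rw [Matrix.mul_add, Matrix.add_mul]
  map_smul' c ρ := by rw [Matrix.mul_smul, Matrix.smul_mul]; rfl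

/-- The map `ρ ↦ K ρ K†`. -/
def conjBy {A B : Type u} [Fintype A] (K : Matrix B A ℂ) : Superop A B := sandwich K K

/-- The extension of `(C, F)` to the direct sum with the one-dimensional vacuum space (with vacuum
amplitude one), in block form: the second block is the vacuum. -/
def vacExt {A B : Type u} [Fintype A] (C : Superop A B) (F : Matrix B A ℂ) :
    Superop (A ⊕ PUnit.{u + 1}) (B ⊕ PUnit.{u + 1}) where
  toFun ρ := Matrix.fromBlocks (C ρ.toBlocks₁₁) (F * ρ.toBlocks₁₂)
    (ρ.toBlocks₂₁ * F.conjTranspose) ρ.toBlocks₂₂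
  map_add' ρ σ := by
    have h₁ : (ρ + σ).toBlocks₁₁ = ρ.toBlocks₁₁ + σ.toBlocks₁₁ := rfl
    have h₂ : (ρ + σ).toBlocks₁₂ = ρ.toBlocks₁₂ + σ.toBlocks₁₂ := rfl
    have h₃ : (ρ + σ).toBlocks₂₁ = ρ.toBlocks₂₁ + σ.toBlocks₂₁ := rfl
    have h₄ : (ρ + σ).toBlocks₂₂ = ρ.toBlocks₂₂ + σ.toBlocks₂₂ := rfl
    rw [h₁, h₂, h₃, h₄, map_add, Matrix.mul_add, Matrix.add_mul, Matrix.fromBlocks_add]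
  map_smul' c ρ := by
    have h₁ : (c • ρ).toBlocks₁₁ = c • ρ.toBlocks₁₁ := rfl
    have h₂ : (c • ρ).toBlocks₁₂ = c • ρ.toBlocks₁₂ := rfl
    have h₃ : (c • ρ).toBlocks₂₁ = c • ρ.toBlocks₂₁ := rfl
    have h₄ : (c • ρ).toBlocks₂₂ = c • ρ.toBlocks₂₂ := rfl
    rw [h₁, h₂, h₃, h₄, map_smul, Matrix.mul_smul, Matrix.smul_mul, RingHom.id_apply,
      Matrix.fromBlocks_smul]

/-! ### Denotational semantics -/

/-- Pairs `(C, F)` of a map on operators and a transformation matrix, from `Γ` to `Δ`. -/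
abbrev Den {X : Type u} (Γ Δ : Finset X) : Type u := Superop (BasisIdx Γ) (BasisIdx Δ) × Op Γ Δ

/-- The set `K_{Γ;Δ}` of the pairs `(C, F)` where `C` and the vacuum extension are quantum
operations. -/
def domK {X : Type u} [DecidableEq X] (Γ Δ : Finset X) : Set (Den Γ Δ) :=
  {x | IsQO x.1 ∧ IsQO (vacExt x.1 x.2)}

/-- The order on pairs: the Löwner order on the vacuum extensions. By linearity,
`(V ⊗ id)(ρ) ≤ (W ⊗ id)(ρ)` for all density matrices `ρ` means that `W - V` is completely
positive. -/
def Den.le {X : Type u} [DecidableEq X] {Γ Δ : Finset X} (x y : Den Γ Δ) : Prop :=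
  IsCP (vacExt y.1 y.2 - vacExt x.1 x.2)

/-- `x` is the least fixed point of `f` in `K_{Γ;Γ}`. -/
def IsLfp {X : Type u} [DecidableEq X] {Γ : Finset X} (f : Den Γ Γ → Den Γ Γ) (x : Den Γ Γ) :
    Prop :=
  x ∈ domK Γ Γ ∧ f x = x ∧ ∀ y ∈ domK Γ Γ, f y = y → Den.le x y

open Classical in
/-- The least fixed point of `f` in `K_{Γ;Γ}` (a default value if there is none). -/
noncomputable def lfp {X : Type u} [DecidableEq X] {Γ : Finset X} (f : Den Γ Γ → Den Γ Γ) :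
    Den Γ Γ :=
  if h : ∃ x, IsLfp f x then h.choose else (0, 0)

/-- `y ∘ x`: first `x`, then `y`. -/
def Den.comp {X : Type u} [DecidableEq X] {Γ Γ' Γ'' : Finset X} (y : Den Γ' Γ'') (x : Den Γ Γ') :
    Den Γ Γ'' :=
  (y.1 ∘ₗ x.1, y.2 * x.2)

/-- The measurement operation on pairs. -/
noncomputable def Den.meas {X : Type u} [DecidableEq X] {Γ Γ' : Finset X} (q : X)
    (x₀ x₁ : Den Γ Γ') : Den Γ Γ' :=
  (x₀.1 ∘ₗ conjBy (proj q 0 Γ) + x₁.1 ∘ₗ conjBy (proj q 1 Γ), x₀.2 * proj q 0 Γ)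

/-- The quantum case on pairs. Here `|k⟩⟨k|_q ⊗ F_k` is `|k⟩_q F_k ⟨k|_q`, and `P_k ⊗ C_k` is
`ρ ↦ |k⟩_q C_k(⟨k|_q ρ |k⟩_q) ⟨k|_q`. -/
noncomputable def Den.qcase {X : Type u} [DecidableEq X] {Γ Γ' : Finset X} (q : X)
    (x₀ x₁ : Den (Γ.erase q) Γ') : Den Γ (insert q Γ') :=
  let i₀ : Op Γ (Γ.erase q) := bra q 0 Γ (Γ.erase q)
  let i₁ : Op Γ (Γ.erase q) := bra q 1 Γ (Γ.erase q)
  let o₀ : Op Γ' (insert q Γ') := ket q 0 Γ' (insert q Γ')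
  let o₁ : Op Γ' (insert q Γ') := ket q 1 Γ' (insert q Γ')
  let G₀ : Op Γ (insert q Γ') := o₀ * x₀.2 * i₀
  let G₁ : Op Γ (insert q Γ') := o₁ * x₁.2 * i₁
  (conjBy o₀ ∘ₗ x₀.1 ∘ₗ conjBy i₀ + conjBy o₁ ∘ₗ x₁.1 ∘ₗ conjBy i₁ + sandwich G₀ G₁ + sandwich G₁ G₀,
    G₀ + G₁)

/-- The denotation `⟦S⟧_Γ` of a program, by recursion on the derivation of its well-formedness
(which is determined by `Γ` and `S`). -/
noncomputable def denote {X : Type u} [DecidableEq X] :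
    {Γ : Finset X} → {S : Stmt X} → {Δ : Finset X} → Typing Γ S Δ → Den Γ Δ
  | _, _, _, .skip => (LinearMap.id, 1)
  | _, _, _, @Typing.newQbit _ _ Γ q _ =>
      (conjBy (ket q 0 Γ (insert q Γ)), ket q 0 Γ (insert q Γ))
  | _, _, _, @Typing.discard _ _ Γ q _ =>
      (conjBy (bra q 0 Γ (Γ.erase q)) + conjBy (bra q 1 Γ (Γ.erase q)), bra q 0 Γ (Γ.erase q))
  | _, _, _, @Typing.gate _ _ Γ q U _ => (conjBy (gateOp q U.1 Γ), gateOp q U.1 Γ)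
  | _, _, _, .seq d₀ d₁ => (denote d₁).comp (denote d₀)
  | _, _, _, @Typing.meas _ _ _ _ q _ _ _ d₀ d₁ => Den.meas q (denote d₀) (denote d₁)
  | _, _, _, @Typing.whileDo _ _ _ q _ _ d =>
      lfp fun x => Den.meas q (LinearMap.id, 1) (x.comp (denote d))
  | _, _, _, @Typing.qcase _ _ _ _ q _ _ _ _ _ d₀ d₁ => Den.qcase q (denote d₀) (denote d₁)

/-- The operator `|ψ⟩⟨ψ|`. -/
noncomputable def pure {X : Type u} {Γ : Finset X} (ψ : Hilb Γ) : Op Γ Γ :=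
  Matrix.vecMulVec ψ.ofLp (star ψ.ofLp)

end QCtrl

namespace QCtrl

open Filter Topology Matrix

/-! ### Positive semidefinite matrices -/

section PosSemidef

variable {n : Type*} [Fintype n]

/-! The trace identity alone does not survive induction, because the states reached by one statement
are fed to the next. What propagates is `SumsTo`: over all derivations, the operators |ψ'⟩⟨ψ'| add
up to C(|ψ⟩⟨ψ|), tested against every functional that is nonnegative on positive operators. Such
functionals pull back along completely positive maps, which settles sequencing, and sums in
`ENNReal` always exist and rearrange freely. The theorem is the case of the trace.

The quantum case superposes branches, so the ensembles alone do not determine its outcome. Here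
`exists_unique_true_deriv` enters: exactly one derivation has bit one, and it ends in Fψ. A pair of
derivations with both bits one gives the coherent output, a pair with one bit one gives a vector in
a single branch, and all other pairs give the zero vector. Removing Fψ from the ensemble of a branch
leaves C − F(·)F†, and `Den.qcase_fst_eq` decomposes the denotation in the same way. Complete
positivity of C − F(·)F† is the core of the invariant `Den.Regular`, which also gives membership in
K.

For loops, `lfp_loop` identifies the least fixed point with the limit of the iterates from zero.
`SumsTo.whileDo` then bounds the sum above by truncating derivations by size, and below by the
iterates.

Finite total mass bounds the multiplicity of a value with nonzero state; uniqueness of the bit-one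
derivation covers the zero vector with bit one. -/

theorem posSemidef_of_tendsto {M : ℕ → Matrix n n ℂ} {L : Matrix n n ℂ}
    (hM : ∀ k, (M k).PosSemidef) (h : Tendsto M atTop (𝓝 L)) : L.PosSemidef := by
  refine Matrix.PosSemidef.of_dotProduct_mulVec_nonneg ?_ fun x => ?_
  · have h' : Tendsto (fun k => (M k)ᴴ) atTop (𝓝 Lᴴ) :=
      ((continuous_id.matrix_conjTranspose).tendsto L).comp h
    refine tendsto_nhds_unique h' (h.congr fun k => ?_)
    exact (hM k).isHermitian.symm
  · have h' : Tendsto (fun k => star x ⬝ᵥ (M k) *ᵥ x) atTop (𝓝 (star x ⬝ᵥ L *ᵥ x)) :=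
      ((continuous_const.dotProduct
        (continuous_id.matrix_mulVec continuous_const)).tendsto L).comp h
    exact ge_of_tendsto' h' fun k => (hM k).dotProduct_mulVec_nonneg x

theorem PosSemidef.trace_re_nonneg {M : Matrix n n ℂ} (hM : M.PosSemidef) :
    0 ≤ M.trace.re := (Complex.le_def.1 hM.trace_nonneg).1

/-- The principal minor on i, j is nonnegative, so |M i j|² ≤ M i i · M j j ≤ (tr M)². Control of
the trace thus controls every entry. -/
theorem PosSemidef.norm_apply_le {M : Matrix n n ℂ} (hM : M.PosSemidef) (i j : n) :
    ‖M i j‖ ≤ M.trace.re := by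
  have hd : ∀ k, 0 ≤ (M k k).re := fun k => (Complex.le_def.1 hM.diag_nonneg).1
  have hi : ∀ k, (M k k).im = 0 := fun k => (Complex.le_def.1 hM.diag_nonneg).2.symm
  have hle : ∀ k, (M k k).re ≤ M.trace.re := fun k => by
    rw [Matrix.trace, Complex.re_sum]
    exact Finset.single_le_sum (f := fun k => (M k k).re) (fun k _ => hd k) (Finset.mem_univ k)
  have hdet := (hM.submatrix ![i, j]).det_nonneg
  rw [Matrix.det_fin_two] at hdet
  simp only [Matrix.submatrix_apply, Matrix.cons_val_zero, Matrix.cons_val_one] at hdet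
  have hs : M j i = star (M i j) := (hM.isHermitian.apply j i).symm
  have h1 : M i j * M j i = ((‖M i j‖ ^ 2 : ℝ) : ℂ) := by
    rw [hs, Complex.star_def, Complex.mul_conj, Complex.normSq_eq_norm_sq]
  rw [h1] at hdet
  have h2 := (Complex.le_def.1 hdet).1
  simp only [Complex.zero_re, Complex.sub_re, Complex.mul_re, hi, mul_zero, sub_zero,
    Complex.ofReal_re] at h2
  have h3 : (M i i).re * (M j j).re ≤ M.trace.re * M.trace.re :=
    mul_le_mul (hle i) (hle j) (hd j) ((hd i).trans (hle i))
  exact abs_le_of_sq_le_sq' (by nlinarith) ((hd i).trans (hle i)) |>.2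

/-- The traces increase and are bounded, hence Cauchy; `PosSemidef.norm_apply_le`, applied to
differences, makes every entry Cauchy. -/
theorem exists_tendsto_of_monotone {M : ℕ → Matrix n n ℂ} {c : ℝ}
    (hM : ∀ k, (M (k + 1) - M k).PosSemidef) (hc : ∀ k, (M k).trace.re ≤ c) :
    ∃ L, Tendsto M atTop (𝓝 L) := by
  have hmono : ∀ k l, k ≤ l → (M l - M k).PosSemidef := by
    intro k l hkl
    induction l, hkl using Nat.le_induction with
    | base => simpa using Matrix.PosSemidef.zero
    | succ l _ ih => simpa using (hM l).add ih
  have ht : Monotone fun k => (M k).trace.re := monotone_nat_of_le_succ fun k => by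
    have := PosSemidef.trace_re_nonneg (hM k)
    rw [Matrix.trace_sub, Complex.sub_re] at this
    linarith
  have hcau : CauchySeq fun k => (M k).trace.re :=
    (tendsto_atTop_ciSup ht ⟨c, by rintro _ ⟨k, rfl⟩; exact hc k⟩).cauchySeq
  have hentry : ∀ i j, ∃ l, Tendsto (fun k => M k i j) atTop (𝓝 l) := by
    intro i j
    refine cauchySeq_tendsto_of_complete (Metric.cauchySeq_iff'.2 fun ε hε => ?_)
    obtain ⟨N, hN⟩ := Metric.cauchySeq_iff'.1 hcau ε hε
    refine ⟨N, fun k hk => lt_of_le_of_lt ?_ (hN k hk)⟩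
    have := PosSemidef.norm_apply_le (hmono N k hk) i j
    rw [Matrix.trace_sub, Complex.sub_re, Matrix.sub_apply] at this
    rw [dist_eq_norm, Real.dist_eq]
    exact this.trans (le_abs_self _)
  choose l hl using hentry
  exact ⟨Matrix.of l, tendsto_pi_nhds.2 fun i => tendsto_pi_nhds.2 fun j => hl i j⟩

-- Lets equality and convergence of superoperators be checked on positive matrices only.
open scoped MatrixOrder Matrix.Norms.L2Operator in
theorem span_posSemidef (n : Type*) [Fintype n] :
    Submodule.span ℂ {M : Matrix n n ℂ | M.PosSemidef} = ⊤ := by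
  classical
  have := CStarAlgebra.span_nonneg (A := Matrix n n ℂ)
  simpa only [Matrix.nonneg_iff_posSemidef] using this

/-- The difference has trace zero, so all its entries vanish by `PosSemidef.norm_apply_le`. -/
theorem PosSemidef.antisymm {M N : Matrix n n ℂ} (h : (M - N).PosSemidef)
    (h' : (N - M).PosSemidef) : M = N := by
  have e : N - M = -(M - N) := (neg_sub _ _).symm
  have h0 : (M - N).trace.re = 0 := le_antisymm
    (by have := PosSemidef.trace_re_nonneg h'; rw [e, Matrix.trace_neg, Complex.neg_re] at this
        linarith) (PosSemidef.trace_re_nonneg h)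
  refine sub_eq_zero.1 (Matrix.ext fun i j => ?_)
  have := PosSemidef.norm_apply_le h i j
  rw [h0] at this
  simpa using this

end PosSemidef

/-! ### Completely positive maps -/

section CP

variable {A B D : Type u}

theorem IsCP.zero : IsCP (0 : Superop A B) := fun _ _ _ => Matrix.PosSemidef.zero

theorem IsCP.id : IsCP (LinearMap.id : Superop A A) := fun _ _ h => h

theorem IsCP.add {C C' : Superop A B} (h : IsCP C) (h' : IsCP C') : IsCP (C + C') :=
  fun n ρ hρ => (h n ρ hρ).add (h' n ρ hρ)

theorem IsCP.comp {C : Superop A B} {C' : Superop B D} (h' : IsCP C') (h : IsCP C) :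
    IsCP (C' ∘ₗ C) :=
  fun n ρ hρ => h' n _ (h n ρ hρ)

/-- Complete positivity with a one-dimensional ancilla. -/
theorem IsCP.posSemidef {C : Superop A B} (h : IsCP C) {ρ : Matrix A A ℂ} (hρ : ρ.PosSemidef) :
    (C ρ).PosSemidef :=
  (h 1 (ρ.submatrix Prod.fst Prod.fst) (hρ.submatrix _)).submatrix fun b => (b, 0)

theorem tensorId_conjBy [Fintype A] (K : Matrix B A ℂ) (n : ℕ)
    (ρ : Matrix (A × Fin n) (A × Fin n) ℂ) :
    tensorId (conjBy K) (Fin n) ρ =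
      Matrix.kronecker K (1 : Matrix (Fin n) (Fin n) ℂ) * ρ *
        (Matrix.kronecker K (1 : Matrix (Fin n) (Fin n) ℂ)).conjTranspose := by
  ext ⟨b, e⟩ ⟨b', e'⟩
  simp [tensorId, conjBy, sandwich, Matrix.mul_apply, Fintype.sum_prod_type, Matrix.one_apply,
    apply_ite (star : ℂ → ℂ)]

theorem IsCP.conjBy [Fintype A] [Fintype B] (K : Matrix B A ℂ) : IsCP (conjBy K) := fun n ρ hρ => by
  rw [tensorId_conjBy]
  exact hρ.mul_mul_conjTranspose_same _

theorem IsCP.of_tendsto [Fintype B] {C : ℕ → Superop A B} {L : Superop A B}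
    (hC : ∀ k, IsCP (C k)) (h : ∀ ρ, Tendsto (fun k => C k ρ) atTop (𝓝 (L ρ))) : IsCP L := by
  intro n ρ hρ
  refine posSemidef_of_tendsto (fun k => hC k n ρ hρ) ?_
  refine tendsto_pi_nhds.2 fun x => tendsto_pi_nhds.2 fun y => ?_
  exact tendsto_pi_nhds.1 (tendsto_pi_nhds.1
    (h (Matrix.of fun a a' => ρ (a, x.2) (a', y.2))) x.1) y.1

theorem superop_ext [Fintype A] {C C' : Superop A B}
    (h : ∀ ρ : Matrix A A ℂ, ρ.PosSemidef → C ρ = C' ρ) : C = C' :=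
  LinearMap.ext_on (span_posSemidef A) fun _ hρ => h _ hρ

@[simp] theorem conjBy_apply [Fintype A] (K : Matrix B A ℂ) (ρ : Matrix A A ℂ) :
    conjBy K ρ = K * ρ * Kᴴ := rfl

@[simp] theorem sandwich_apply [Fintype A] (K L : Matrix B A ℂ) (ρ : Matrix A A ℂ) :
    sandwich K L ρ = K * ρ * Lᴴ := rfl

theorem conjBy_mul [Fintype A] [Fintype B] (K : Matrix D B ℂ) (L : Matrix B A ℂ) :
    conjBy (K * L) = conjBy K ∘ₗ conjBy L := by
  ext1 ρ
  simp [Matrix.mul_assoc]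

variable (A) in
/-- The inclusion of the first summand of `ℂ^A ⊕ ℂ`. -/
noncomputable def inlMat [DecidableEq A] : Matrix (A ⊕ PUnit.{u + 1}) A ℂ := Matrix.fromRows 1 0

theorem inlMat_mul_mul [Fintype A] [DecidableEq A] (M : Matrix A A ℂ) :
    inlMat A * M * (inlMat A)ᴴ = Matrix.fromBlocks M 0 0 0 := by
  rw [inlMat, Matrix.fromRows_mul, Matrix.conjTranspose_fromRows_eq_fromCols_conjTranspose,
    Matrix.fromRows_mul_fromCols]
  simp

theorem inlMat_conjTranspose_mul_mul [Fintype A] [DecidableEq A]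
    (M : Matrix (A ⊕ PUnit.{u + 1}) (A ⊕ PUnit.{u + 1}) ℂ) :
    (inlMat A)ᴴ * M * inlMat A = M.toBlocks₁₁ := by
  conv_lhs => rw [← Matrix.fromBlocks_toBlocks M]
  rw [inlMat, Matrix.conjTranspose_fromRows_eq_fromCols_conjTranspose,
    Matrix.fromCols_mul_fromBlocks, Matrix.fromCols_mul_fromRows]
  simp

theorem vacExt_apply [Fintype A] (C : Superop A B) (F : Matrix B A ℂ)
    (ρ : Matrix (A ⊕ PUnit.{u + 1}) (A ⊕ PUnit.{u + 1}) ℂ) :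
    vacExt C F ρ = Matrix.fromBlocks (C ρ.toBlocks₁₁) (F * ρ.toBlocks₁₂)
      (ρ.toBlocks₂₁ * F.conjTranspose) ρ.toBlocks₂₂ := rfl

/-- With a common F the off-diagonal and vacuum blocks cancel, so the difference compresses to the
first summand, applies C − C' and embeds back. -/
theorem vacExt_sub_vacExt [Fintype A] [Fintype B] [DecidableEq A] [DecidableEq B]
    (C C' : Superop A B) (F : Matrix B A ℂ) :
    vacExt C F - vacExt C' F =
      conjBy (inlMat B) ∘ₗ (C - C') ∘ₗ conjBy (inlMat A)ᴴ := by
  ext1 ρ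
  simp only [LinearMap.sub_apply, LinearMap.comp_apply, conjBy_apply, vacExt_apply,
    Matrix.conjTranspose_conjTranspose, inlMat_conjTranspose_mul_mul, inlMat_mul_mul]
  ext (i | i) (j | j) <;> simp

theorem IsCP.vacExt_sub_vacExt [Fintype A] [Fintype B] {C C' : Superop A B}
    (h : IsCP (C - C')) (F : Matrix B A ℂ) : IsCP (vacExt C F - vacExt C' F) := by
  classical
  rw [QCtrl.vacExt_sub_vacExt]
  exact (IsCP.conjBy _).comp (h.comp (IsCP.conjBy _))

/-- The single Kraus operator is F ⊕ 1. -/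
theorem vacExt_conjBy [Fintype A] (F : Matrix B A ℂ) :
    vacExt (conjBy F) F = conjBy (Matrix.fromBlocks F 0 0 (1 : Matrix PUnit PUnit ℂ)) := by
  ext1 ρ
  conv_rhs => rw [← Matrix.fromBlocks_toBlocks ρ]
  rw [conjBy_apply, vacExt_apply, Matrix.fromBlocks_conjTranspose, Matrix.fromBlocks_multiply,
    Matrix.fromBlocks_multiply]
  simp

theorem IsCP.vacExt [Fintype A] [Fintype B] {C : Superop A B} {F : Matrix B A ℂ}
    (h : IsCP (C - QCtrl.conjBy F)) : IsCP (vacExt C F) := by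
  have := (h.vacExt_sub_vacExt F).add (IsCP.conjBy (Matrix.fromBlocks F 0 0 1))
  rwa [← vacExt_conjBy, sub_add_cancel] at this

/-- Evaluate on ρ ⊕ 0 and read off the first diagonal block; F and F' play no role there. -/
theorem posSemidef_sub_of_isCP_vacExt_sub [Fintype A] [Fintype B] {C C' : Superop A B}
    {F F' : Matrix B A ℂ} (h : IsCP (QCtrl.vacExt C F - QCtrl.vacExt C' F')) {ρ : Matrix A A ℂ}
    (hρ : ρ.PosSemidef) : (C ρ - C' ρ).PosSemidef := by
  classical
  have h1 : (Matrix.fromBlocks ρ 0 0 (0 : Matrix PUnit PUnit ℂ)).PosSemidef := by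
    rw [← inlMat_mul_mul]
    exact hρ.mul_mul_conjTranspose_same _
  have h2 := (h.posSemidef h1).submatrix Sum.inl
  exact h2

/-- Trace non-increasing maps. -/
def TraceNonincr [Fintype A] [Fintype B] (C : Superop A B) : Prop :=
  ∀ ρ : Matrix A A ℂ, ρ.PosSemidef → (C ρ).trace.re ≤ ρ.trace.re

theorem TraceNonincr.comp [Fintype A] [Fintype B] [Fintype D] {C : Superop A B} {C' : Superop B D}
    (h' : TraceNonincr C') (h : TraceNonincr C) (hC : IsCP C) : TraceNonincr (C' ∘ₗ C) :=
  fun ρ hρ => (h' _ (hC.posSemidef hρ)).trans (h ρ hρ)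

theorem trace_conjBy [Fintype A] [Fintype B] (K : Matrix B A ℂ) (ρ : Matrix A A ℂ) :
    (conjBy K ρ).trace = (Kᴴ * K * ρ).trace := by
  rw [conjBy_apply, Matrix.trace_mul_comm, Matrix.mul_assoc]

theorem TraceNonincr.conjBy [Fintype A] [Fintype B] [DecidableEq A] {K : Matrix B A ℂ}
    (hK : Kᴴ * K = 1) : TraceNonincr (conjBy K) := fun ρ _ => by
  rw [trace_conjBy, hK, Matrix.one_mul]

theorem TraceNonincr.vacExt [Fintype A] [Fintype B] {C : Superop A B} (h : TraceNonincr C)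
    (F : Matrix B A ℂ) : TraceNonincr (QCtrl.vacExt C F) := fun ρ hρ => by
  have h1 : ρ.toBlocks₁₁.PosSemidef := hρ.submatrix Sum.inl
  have h2 := h _ h1
  conv_rhs => rw [← Matrix.fromBlocks_toBlocks ρ]
  rw [vacExt_apply]
  simpa [Matrix.trace, Fintype.sum_sum_type] using h2

end CP

/-! ### Elementary operators -/

section Ket

theorem bra_conjTranspose {X : Type u} (q : X) (b : Fin 2) (Δ Γ : Finset X) :
    (bra q b Δ Γ)ᴴ = ket q b Γ Δ :=
  Matrix.conjTranspose_conjTranspose _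

variable {X : Type u} [DecidableEq X]

/-- The basis label of `q, Γ` given by a bit for `q` and a basis label of `Γ`. -/
def extIdx (q : X) (Γ : Finset X) (b : Fin 2) (g : BasisIdx Γ) : BasisIdx (insert q Γ) :=
  fun x => if h : x.1 = q then b else g ⟨x.1, Finset.mem_of_mem_insert_of_ne x.2 h⟩

variable {q : X} {Γ : Finset X}

/-- Turns the two clauses in `ket` into one equation of labels, so that `ket` becomes the matrix of
the injection `extIdx`. -/
theorem extIdx_eq_iff (hq : q ∉ Γ) (b : Fin 2) (g : BasisIdx Γ) (f : BasisIdx (insert q Γ)) :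
    f = extIdx q Γ b g ↔ (∀ h : q ∈ insert q Γ, f ⟨q, h⟩ = b) ∧
      ∀ x, ∀ h : x ∈ insert q Γ, ∀ h' : x ∈ Γ, f ⟨x, h⟩ = g ⟨x, h'⟩ := by
  constructor
  · rintro rfl
    refine ⟨fun h => by simp [extIdx], fun x h h' => ?_⟩
    have : x ≠ q := fun e => hq (e ▸ h')
    simp [extIdx, this]
  · rintro ⟨h0, h1⟩
    funext ⟨x, hx⟩
    by_cases h : x = q
    · subst h; simp [extIdx, h0]
    · simp [extIdx, h, h1 x hx (Finset.mem_of_mem_insert_of_ne hx h)]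

theorem ket_insert_apply (hq : q ∉ Γ) (b : Fin 2) (f : BasisIdx (insert q Γ)) (g : BasisIdx Γ) :
    ket q b Γ (insert q Γ) f g = if f = extIdx q Γ b g then 1 else 0 := by
  unfold ket
  rw [Matrix.of_apply]
  by_cases h : f = extIdx q Γ b g
  · rw [if_pos h, if_pos ((extIdx_eq_iff hq b g f).1 h)]
  · rw [if_neg h, if_neg (mt (extIdx_eq_iff hq b g f).2 h)]

theorem extIdx_inj (hq : q ∉ Γ) {b b' : Fin 2} {g g' : BasisIdx Γ} :
    extIdx q Γ b g = extIdx q Γ b' g' ↔ b = b' ∧ g = g' := by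
  refine ⟨fun h => ?_, by rintro ⟨rfl, rfl⟩; rfl⟩
  obtain ⟨h0, h1⟩ := (extIdx_eq_iff hq b' g' _).1 h
  obtain ⟨k0, k1⟩ := (extIdx_eq_iff hq b g _).1 rfl
  refine ⟨(k0 (Finset.mem_insert_self _ _)).symm.trans (h0 (Finset.mem_insert_self _ _)), ?_⟩
  funext ⟨x, hx⟩
  exact (k1 x (Finset.mem_insert_of_mem hx) hx).symm.trans (h1 x (Finset.mem_insert_of_mem hx) hx)

theorem exists_eq_extIdx (hq : q ∉ Γ) (f : BasisIdx (insert q Γ)) :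
    ∃ b g, f = extIdx q Γ b g :=
  ⟨f ⟨q, Finset.mem_insert_self _ _⟩, fun x => f ⟨x, Finset.mem_insert_of_mem x.2⟩,
    (extIdx_eq_iff hq _ _ _).2 ⟨fun _ => rfl, fun _ _ _ => rfl⟩⟩

theorem ket_conjTranspose_mul_ket_insert (hq : q ∉ Γ) (b b' : Fin 2) :
    (ket q b Γ (insert q Γ))ᴴ * ket q b' Γ (insert q Γ) = if b = b' then 1 else 0 := by
  ext g g'
  simp only [Matrix.mul_apply, Matrix.conjTranspose_apply, ket_insert_apply hq,
    apply_ite (star : ℂ → ℂ), star_one, star_zero, ite_mul, one_mul, zero_mul,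
    Finset.sum_ite_eq', Finset.mem_univ, if_true, extIdx_inj hq]
  by_cases hb : b = b' <;> simp [hb, Matrix.one_apply]

theorem sum_ket_mul_conjTranspose_insert (hq : q ∉ Γ) :
    ket q 0 Γ (insert q Γ) * (ket q 0 Γ (insert q Γ))ᴴ +
      ket q 1 Γ (insert q Γ) * (ket q 1 Γ (insert q Γ))ᴴ = 1 := by
  rw [← Fin.sum_univ_two fun b => ket q b Γ (insert q Γ) * (ket q b Γ (insert q Γ))ᴴ]
  ext f f'
  obtain ⟨b, g, rfl⟩ := exists_eq_extIdx hq f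
  obtain ⟨b', g', rfl⟩ := exists_eq_extIdx hq f'
  simp only [Matrix.sum_apply, Matrix.mul_apply, Matrix.conjTranspose_apply, ket_insert_apply hq,
    apply_ite (star : ℂ → ℂ), star_one, star_zero, ite_mul, one_mul, zero_mul, extIdx_inj hq,
    Matrix.one_apply]
  rw [Finset.sum_eq_single b (fun c _ hc => by simp [Ne.symm hc]) (by simp),
    Finset.sum_eq_single g (fun c _ hc => by simp [Ne.symm hc]) (by simp)]
  simp [eq_comm]

theorem bra_mul_ket (hq : q ∉ Γ) (b b' : Fin 2) :
    bra q b (insert q Γ) Γ * ket q b' Γ (insert q Γ) = if b = b' then 1 else 0 :=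
  ket_conjTranspose_mul_ket_insert hq b b'

theorem bra_erase_mul_ket (hq : q ∈ Γ) (b b' : Fin 2) :
    bra q b Γ (Γ.erase q) * ket q b' (Γ.erase q) Γ = if b = b' then 1 else 0 := by
  have h := bra_mul_ket (Finset.notMem_erase q Γ) b b'
  rwa [Finset.insert_erase hq] at h

theorem sum_proj (hq : q ∈ Γ) : proj q 0 Γ + proj q 1 Γ = 1 := by
  have h := sum_ket_mul_conjTranspose_insert (Finset.notMem_erase q Γ)
  rwa [Finset.insert_erase hq] at h

theorem proj_conjTranspose_mul_proj (hq : q ∈ Γ) (b : Fin 2) :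
    (proj q b Γ)ᴴ * proj q b Γ = proj q b Γ := by
  rw [proj, Matrix.conjTranspose_mul, bra_conjTranspose, Matrix.mul_assoc, ← bra,
    ← Matrix.mul_assoc (bra q b Γ _), bra_erase_mul_ket hq, if_pos rfl, Matrix.one_mul]

theorem gateOp_conjTranspose_mul_gateOp (hq : q ∈ Γ) (U : Matrix.unitaryGroup (Fin 2) ℂ) :
    (gateOp q U.1 Γ)ᴴ * gateOp q U.1 Γ = 1 := by
  have hU : star U.1 * U.1 = 1 := Matrix.UnitaryGroup.star_mul_self U
  have h := fun b b' => congrFun (congrFun hU b) b'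
  simp only [Matrix.mul_apply, Matrix.star_apply, Fin.sum_univ_two, Matrix.one_apply] at h
  have h00 := h 0 0
  have h01 := h 0 1
  have h10 := h 1 0
  have h11 := h 1 1
  -- The operators |a⟩⟨b| on q multiply like matrix units, which reduces the claim to the four
  -- entries of U†U = 1.
  have key : ∀ a b a' b', (ket q a (Γ.erase q) Γ * bra q b Γ (Γ.erase q))ᴴ *
      (ket q a' (Γ.erase q) Γ * bra q b' Γ (Γ.erase q)) =
      if a = a' then ket q b (Γ.erase q) Γ * bra q b' Γ (Γ.erase q) else 0 := by
    intro a b a' b'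
    rw [Matrix.conjTranspose_mul, bra_conjTranspose, Matrix.mul_assoc, ← bra,
      ← Matrix.mul_assoc (bra q a Γ _), bra_erase_mul_ket hq]
    split_ifs <;> simp
  have hs := sum_proj hq
  rw [proj, proj] at hs
  simp only [gateOp, Fin.sum_univ_two, Matrix.conjTranspose_add, Matrix.conjTranspose_smul,
    Matrix.add_mul, Matrix.mul_add, Matrix.smul_mul, Matrix.mul_smul, key]
  simp only [if_true, one_ne_zero, zero_ne_one, if_false, smul_zero, add_zero, zero_add]
  rw [← hs]
  ext f f'
  simp at h00 h01 h10 h11 ⊢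
  linear_combination (ket q 0 (Γ.erase q) Γ * bra q 0 Γ (Γ.erase q)) f f' * h00 +
    (ket q 0 (Γ.erase q) Γ * bra q 1 Γ (Γ.erase q)) f f' * h01 +
    (ket q 1 (Γ.erase q) Γ * bra q 0 Γ (Γ.erase q)) f f' * h10 +
    (ket q 1 (Γ.erase q) Γ * bra q 1 Γ (Γ.erase q)) f f' * h11

end Ket

/-! ### Denotations are quantum operations -/

section Regular

variable {X : Type u} [DecidableEq X] {Γ Γ' Γ'' : Finset X} {q : X}

/-- A sufficient condition for membership in `K_{Γ;Γ'}`, stable under all the constructions. -/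
structure Den.Regular (x : Den Γ Γ') : Prop where
  isCP_sub : IsCP (x.1 - conjBy x.2)
  traceNonincr : TraceNonincr x.1

theorem Den.Regular.isCP {x : Den Γ Γ'} (h : x.Regular) : IsCP x.1 := by
  simpa using h.isCP_sub.add (IsCP.conjBy x.2)

theorem Den.Regular.mem_domK {x : Den Γ Γ'} (h : x.Regular) : x ∈ domK Γ Γ' :=
  ⟨⟨h.isCP, h.traceNonincr⟩, h.isCP_sub.vacExt, h.traceNonincr.vacExt _⟩

theorem Den.Regular.of_isometry {K : Op Γ Γ'} (hK : Kᴴ * K = 1) :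
    Den.Regular ((QCtrl.conjBy K, K) : Den Γ Γ') where
  isCP_sub := by simpa using IsCP.zero
  traceNonincr := TraceNonincr.conjBy hK

theorem Den.Regular.id : Den.Regular ((LinearMap.id, 1) : Den Γ Γ) where
  isCP_sub := by
    have : conjBy (1 : Op Γ Γ) = LinearMap.id := by ext1 ρ; simp
    simpa [this] using IsCP.zero
  traceNonincr _ _ := le_rfl

theorem Den.Regular.discard (hq : q ∈ Γ) :
    Den.Regular ((conjBy (bra q 0 Γ (Γ.erase q)) + conjBy (bra q 1 Γ (Γ.erase q)),
      bra q 0 Γ (Γ.erase q)) : Den Γ (Γ.erase q)) where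
  isCP_sub := by simpa using IsCP.conjBy _
  traceNonincr ρ _ := by
    rw [LinearMap.add_apply, Matrix.trace_add, trace_conjBy, trace_conjBy, ← Matrix.trace_add,
      ← Matrix.add_mul, bra_conjTranspose, bra_conjTranspose, ← proj, ← proj, sum_proj hq,
      Matrix.one_mul]

/-- Telescoping: D∘C − GF(·)(GF)† is (D − G(·)G†)∘C plus G(·)G† after C − F(·)F†. -/
theorem Den.Regular.comp {x : Den Γ Γ'} {y : Den Γ' Γ''} (hy : y.Regular) (hx : x.Regular) :
    (y.comp x).Regular where
  isCP_sub := by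
    have : (y.comp x).1 - conjBy (y.comp x).2 =
        (y.1 - conjBy y.2) ∘ₗ x.1 + conjBy y.2 ∘ₗ (x.1 - conjBy x.2) := by
      simp only [Den.comp, conjBy_mul]
      ext1 ρ
      simp [Matrix.mul_sub, Matrix.sub_mul]
    rw [this]
    exact (hy.isCP_sub.comp hx.isCP).add ((IsCP.conjBy _).comp hx.isCP_sub)
  traceNonincr := hy.traceNonincr.comp hx.traceNonincr hx.isCP

theorem traceNonincr_meas (hq : q ∈ Γ) {C₀ C₁ : Superop (BasisIdx Γ) (BasisIdx Γ')}
    (h₀ : TraceNonincr C₀) (h₁ : TraceNonincr C₁) :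
    TraceNonincr (C₀ ∘ₗ conjBy (proj q 0 Γ) + C₁ ∘ₗ conjBy (proj q 1 Γ)) := fun ρ hρ => by
  have k₀ := h₀ _ ((IsCP.conjBy (proj q 0 Γ)).posSemidef hρ)
  have k₁ := h₁ _ ((IsCP.conjBy (proj q 1 Γ)).posSemidef hρ)
  rw [trace_conjBy, proj_conjTranspose_mul_proj hq] at k₀ k₁
  have : ρ.trace.re = (proj q 0 Γ * ρ).trace.re + (proj q 1 Γ * ρ).trace.re := by
    rw [← Complex.add_re, ← Matrix.trace_add, ← Matrix.add_mul, sum_proj hq, Matrix.one_mul]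
  rw [LinearMap.add_apply, Matrix.trace_add, Complex.add_re, this]
  exact add_le_add k₀ k₁

/-- Only branch 0 enters the transformation matrix, so branch 1 survives the subtraction in full. -/
theorem Den.Regular.meas (hq : q ∈ Γ) {x₀ x₁ : Den Γ Γ'} (h₀ : x₀.Regular) (h₁ : x₁.Regular) :
    (Den.meas q x₀ x₁).Regular where
  isCP_sub := by
    have : (Den.meas q x₀ x₁).1 - conjBy (Den.meas q x₀ x₁).2 =
        (x₀.1 - conjBy x₀.2) ∘ₗ conjBy (proj q 0 Γ) + x₁.1 ∘ₗ conjBy (proj q 1 Γ) := by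
      simp only [Den.meas, conjBy_mul]
      ext1 ρ
      simp only [LinearMap.sub_apply, LinearMap.add_apply, LinearMap.comp_apply]
      abel
    rw [this]
    exact (h₀.isCP_sub.comp (IsCP.conjBy _)).add (h₁.isCP.comp (IsCP.conjBy _))
  traceNonincr := traceNonincr_meas hq h₀.traceNonincr h₁.traceNonincr

/-- The two `sandwich` terms are precisely the cross terms of conjugation by G₀ + G₁. This splits
the quantum case into a coherent part and one incoherent remainder per branch. -/
theorem Den.qcase_fst_eq (x₀ x₁ : Den (Γ.erase q) Γ') :
    (Den.qcase q x₀ x₁).1 = conjBy (Den.qcase q x₀ x₁).2 +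
      conjBy (ket q 0 Γ' (insert q Γ')) ∘ₗ (x₀.1 - conjBy x₀.2) ∘ₗ conjBy (bra q 0 Γ (Γ.erase q)) +
      conjBy (ket q 1 Γ' (insert q Γ')) ∘ₗ (x₁.1 - conjBy x₁.2) ∘ₗ
        conjBy (bra q 1 Γ (Γ.erase q)) := by
  ext1 ρ
  simp only [Den.qcase, LinearMap.sub_apply, LinearMap.add_apply, LinearMap.comp_apply,
    conjBy_apply, sandwich_apply, Matrix.conjTranspose_add, Matrix.conjTranspose_mul,
    Matrix.mul_add, Matrix.add_mul, Matrix.mul_sub, Matrix.sub_mul, Matrix.mul_assoc]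
  abel

theorem trace_conjBy_ket (hq : q ∉ Γ) (b : Fin 2) (ρ : Op Γ Γ) :
    (conjBy (ket q b Γ (insert q Γ)) ρ).trace = ρ.trace := by
  rw [trace_conjBy, ket_conjTranspose_mul_ket_insert hq, if_pos rfl, Matrix.one_mul]

theorem trace_sandwich_ket (hq : q ∉ Γ') {b b' : Fin 2} (hb : b ≠ b') (F G : Op Γ Γ')
    (ρ : Op Γ Γ) :
    (sandwich (ket q b Γ' (insert q Γ') * F) (ket q b' Γ' (insert q Γ') * G) ρ).trace = 0 := by
  rw [sandwich_apply, Matrix.conjTranspose_mul, Matrix.trace_mul_comm, Matrix.mul_assoc,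
    Matrix.mul_assoc, ← Matrix.mul_assoc _ (ket q b Γ' _), ket_conjTranspose_mul_ket_insert hq,
    if_neg hb.symm]
  simp

theorem Den.Regular.qcase (hq : q ∈ Γ) (hq' : q ∉ Γ') {x₀ x₁ : Den (Γ.erase q) Γ'}
    (h₀ : x₀.Regular) (h₁ : x₁.Regular) : (Den.qcase q x₀ x₁).Regular where
  isCP_sub := by
    rw [Den.qcase_fst_eq, add_assoc, add_sub_cancel_left]
    exact ((IsCP.conjBy _).comp (h₀.isCP_sub.comp (IsCP.conjBy _))).add
      ((IsCP.conjBy _).comp (h₁.isCP_sub.comp (IsCP.conjBy _)))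
  traceNonincr ρ hρ := by
    have k₀ := h₀.traceNonincr _ ((IsCP.conjBy (bra q 0 Γ (Γ.erase q))).posSemidef hρ)
    have k₁ := h₁.traceNonincr _ ((IsCP.conjBy (bra q 1 Γ (Γ.erase q))).posSemidef hρ)
    rw [trace_conjBy, bra_conjTranspose, ← proj] at k₀ k₁
    have e : ρ.trace.re = (proj q 0 Γ * ρ).trace.re + (proj q 1 Γ * ρ).trace.re := by
      rw [← Complex.add_re, ← Matrix.trace_add, ← Matrix.add_mul, sum_proj hq, Matrix.one_mul]
    simp only [Den.qcase, LinearMap.add_apply, LinearMap.comp_apply, Matrix.trace_add,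
      Complex.add_re]
    rw [trace_conjBy_ket hq', trace_conjBy_ket hq', Matrix.mul_assoc, Matrix.mul_assoc,
      trace_sandwich_ket hq' zero_ne_one, trace_sandwich_ket hq' one_ne_zero, e]
    simpa using add_le_add k₀ k₁

end Regular

/-! ### The least fixed point of a loop -/

section Loop

variable {X : Type u} [DecidableEq X] {Γ : Finset X} {q : X}

/-- The iterates, starting from zero, of the functional defining a loop on `q` with body `C`. -/
noncomputable def loopIter (q : X) (C : Superop (BasisIdx Γ) (BasisIdx Γ)) :
    ℕ → Superop (BasisIdx Γ) (BasisIdx Γ)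
  | 0 => 0
  | k + 1 => conjBy (proj q 0 Γ) + (loopIter q C k ∘ₗ C) ∘ₗ conjBy (proj q 1 Γ)

variable {C : Superop (BasisIdx Γ) (BasisIdx Γ)}

theorem isCP_loopIter (hC : IsCP C) (k : ℕ) : IsCP (loopIter q C k) := by
  induction k with
  | zero => exact IsCP.zero
  | succ k ih => exact (IsCP.conjBy _).add ((ih.comp hC).comp (IsCP.conjBy _))

/-- The exit term cancels, so each increment is the preceding one precomposed with a further pass
through the loop. -/
theorem isCP_loopIter_succ_sub (hC : IsCP C) (k : ℕ) :
    IsCP (loopIter q C (k + 1) - loopIter q C k) := by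
  induction k with
  | zero => simpa [loopIter] using IsCP.conjBy _
  | succ k ih =>
    have : loopIter q C (k + 1 + 1) - loopIter q C (k + 1) =
        ((loopIter q C (k + 1) - loopIter q C k) ∘ₗ C) ∘ₗ conjBy (proj q 1 Γ) := by
      rw [loopIter, loopIter]
      ext1 ρ
      simp
    rw [this]
    exact (ih.comp hC).comp (IsCP.conjBy _)

theorem traceNonincr_loopIter (hq : q ∈ Γ) (hC : IsCP C) (hC' : TraceNonincr C) (k : ℕ) :
    TraceNonincr (loopIter q C k) := by
  induction k with
  | zero => exact fun ρ hρ => by simpa [loopIter] using PosSemidef.trace_re_nonneg hρ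
  | succ k ih =>
    exact traceNonincr_meas (C₀ := LinearMap.id) hq (fun _ _ => le_rfl) (ih.comp hC' hC)

/-- On positive matrices the iterates increase with bounded trace. Spanning extends convergence to
all matrices, and uniqueness of limits makes the limit linear. -/
theorem exists_tendsto_loopIter (hq : q ∈ Γ) (hC : IsCP C) (hC' : TraceNonincr C) :
    ∃ L : Superop (BasisIdx Γ) (BasisIdx Γ),
      ∀ ρ, Tendsto (fun k => loopIter q C k ρ) atTop (𝓝 (L ρ)) := by
  have h : ∀ ρ : Op Γ Γ, ∃ M, Tendsto (fun k => loopIter q C k ρ) atTop (𝓝 M) := by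
    intro ρ
    have hρ : ρ ∈ Submodule.span ℂ {M : Op Γ Γ | M.PosSemidef} := by
      rw [span_posSemidef]; trivial
    induction hρ using Submodule.span_induction with
    | mem ρ hρ =>
      exact exists_tendsto_of_monotone (fun k => (isCP_loopIter_succ_sub hC k).posSemidef hρ)
        fun k => traceNonincr_loopIter hq hC hC' k ρ hρ
    | zero => exact ⟨0, by simp⟩
    | add ρ σ _ _ hρ hσ =>
      obtain ⟨M, hM⟩ := hρ
      obtain ⟨N, hN⟩ := hσ
      exact ⟨M + N, by simpa using hM.add hN⟩
    | smul c ρ _ hρ =>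
      obtain ⟨M, hM⟩ := hρ
      exact ⟨c • M, by simpa using hM.const_smul c⟩
  choose L hL using h
  refine ⟨⟨⟨L, fun ρ σ => ?_⟩, fun c ρ => ?_⟩, hL⟩
  · exact tendsto_nhds_unique (hL (ρ + σ)) (by simpa using (hL ρ).add (hL σ))
  · exact tendsto_nhds_unique (hL (c • ρ)) (by simpa using (hL ρ).const_smul c)

theorem eq_of_tendsto_loopIter {L : Superop (BasisIdx Γ) (BasisIdx Γ)}
    (hL : ∀ ρ, Tendsto (fun k => loopIter q C k ρ) atTop (𝓝 (L ρ))) :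
    L = conjBy (proj q 0 Γ) + (L ∘ₗ C) ∘ₗ conjBy (proj q 1 Γ) := by
  ext1 ρ
  exact tendsto_nhds_unique ((tendsto_add_atTop_iff_nat 1).2 (hL ρ))
    ((hL (C (conjBy (proj q 1 Γ) ρ))).const_add _)

/-- Domination of every iterate passes to the limit, which is what makes the limit the least fixed
point. -/
theorem isCP_sub_loopIter {Y : Superop (BasisIdx Γ) (BasisIdx Γ)} (hC : IsCP C) (hY : IsCP Y)
    (h : Y = conjBy (proj q 0 Γ) + (Y ∘ₗ C) ∘ₗ conjBy (proj q 1 Γ)) (k : ℕ) :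
    IsCP (Y - loopIter q C k) := by
  induction k with
  | zero => simpa [loopIter] using hY
  | succ k ih =>
    have : Y - loopIter q C (k + 1) = ((Y - loopIter q C k) ∘ₗ C) ∘ₗ conjBy (proj q 1 Γ) := by
      conv_lhs => rw [h, loopIter]
      ext1 ρ
      simp
    rw [this]
    exact (ih.comp hC).comp (IsCP.conjBy _)

/-- Leastness both ways gives opposite Löwner inequalities on the first block. For loops the second
component is read off the fixed-point equation instead. -/
theorem IsLfp.unique {f : Den Γ Γ → Den Γ Γ} {x y : Den Γ Γ} (hx : IsLfp f x) (hy : IsLfp f y) :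
    x.1 = y.1 :=
  superop_ext fun _ hρ => PosSemidef.antisymm
    (posSemidef_sub_of_isCP_vacExt_sub (hy.2.2 x hx.1 hx.2.1) hρ)
    (posSemidef_sub_of_isCP_vacExt_sub (hx.2.2 y hy.1 hy.2.1) hρ)

/-- The least fixed point of a loop is the limit of the iterates from zero. -/
theorem lfp_loop (hq : q ∈ Γ) {y : Den Γ Γ} (hy : y.Regular) :
    ∃ L : Superop (BasisIdx Γ) (BasisIdx Γ),
      (lfp fun x => Den.meas q (LinearMap.id, 1) (x.comp y)) = (L, proj q 0 Γ) ∧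
      (∀ ρ, Tendsto (fun k => loopIter q y.1 k ρ) atTop (𝓝 (L ρ))) ∧
      L = conjBy (proj q 0 Γ) + (L ∘ₗ y.1) ∘ₗ conjBy (proj q 1 Γ) ∧
      Den.Regular ((L, proj q 0 Γ) : Den Γ Γ) := by
  obtain ⟨L, hL⟩ := exists_tendsto_loopIter hq hy.isCP hy.traceNonincr
  have hfix := eq_of_tendsto_loopIter hL
  have hCP : IsCP L := IsCP.of_tendsto (isCP_loopIter hy.isCP) hL
  have hreg : Den.Regular ((L, proj q 0 Γ) : Den Γ Γ) :=
    { isCP_sub := by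
        have : L - conjBy (proj q 0 Γ) = (L ∘ₗ y.1) ∘ₗ conjBy (proj q 1 Γ) :=
          sub_eq_iff_eq_add'.2 hfix
        dsimp only
        rw [this]
        exact (hCP.comp hy.isCP).comp (IsCP.conjBy _)
      traceNonincr := fun ρ hρ => by
        have h : Tendsto (fun k => (loopIter q y.1 k ρ).trace.re) atTop (𝓝 (L ρ).trace.re) :=
          (Complex.continuous_re.tendsto _).comp
            ((continuous_id.matrix_trace.tendsto (L ρ)).comp (hL ρ))
        exact le_of_tendsto' h fun k => traceNonincr_loopIter hq hy.isCP hy.traceNonincr k ρ hρ }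
  have hmeas : ∀ x : Den Γ Γ, Den.meas q (LinearMap.id, 1) (x.comp y) =
      (conjBy (proj q 0 Γ) + (x.1 ∘ₗ y.1) ∘ₗ conjBy (proj q 1 Γ), proj q 0 Γ) := by
    intro x
    simp [Den.meas, Den.comp]
  have hlfp : IsLfp (fun x => Den.meas q (LinearMap.id, 1) (x.comp y)) (L, proj q 0 Γ) := by
    refine ⟨hreg.mem_domK, ?_, fun z hz hfz => ?_⟩
    · dsimp only
      rw [hmeas]
      exact Prod.ext hfix.symm rfl
    · dsimp only at hfz
      rw [hmeas] at hfz
      obtain ⟨Z, G⟩ := z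
      -- The fixed-point equation forces the second component to be |0⟩⟨0| on q, so the vacuum
      -- extensions can be compared through their superoperators alone.
      obtain ⟨hZ, rfl⟩ := Prod.mk.inj hfz
      refine IsCP.vacExt_sub_vacExt ?_ _
      exact IsCP.of_tendsto (isCP_sub_loopIter hy.isCP hz.1.1 hZ.symm)
        fun ρ => (hL ρ).const_sub _
  refine ⟨L, ?_, hL, hfix, hreg⟩
  -- Existence rules out the default value of `lfp`.
  have hex : ∃ x, IsLfp (fun x => Den.meas q (LinearMap.id, 1) (x.comp y)) x := ⟨_, hlfp⟩
  rw [lfp, dif_pos hex]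
  refine Prod.ext (hex.choose_spec.unique hlfp) ?_
  have h2 := hex.choose_spec.2.1
  dsimp only at h2
  rw [hmeas] at h2
  exact (congrArg Prod.snd h2).symm

end Loop

theorem Den.Regular.denote {X : Type u} [DecidableEq X] {Γ Δ : Finset X} {S : Stmt X}
    (d : Typing Γ S Δ) : (QCtrl.denote d).Regular := by
  induction d with
  | skip => exact Den.Regular.id
  | newQbit hq =>
    exact Den.Regular.of_isometry (by rw [ket_conjTranspose_mul_ket_insert hq, if_pos rfl])
  | discard hq => exact Den.Regular.discard hq
  | gate hq => exact Den.Regular.of_isometry (gateOp_conjTranspose_mul_gateOp hq _)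
  | seq _ _ h₀ h₁ => exact h₁.comp h₀
  | meas hq _ _ h₀ h₁ => exact h₀.meas hq h₁
  | whileDo hq _ h =>
    obtain ⟨L, h1, -, -, h2⟩ := lfp_loop hq h
    rw [QCtrl.denote, h1]
    exact h2
  | qcase hq hq' _ _ _ h₀ h₁ => exact h₀.qcase hq hq' h₁

/-! ### Families of derivations -/

section Deriv

variable {X : Type u} [DecidableEq X] {Γ Δ : Finset X} {q : X} {S S₀ S₁ : Stmt X}

/-- Allows all derivations from a typed statement to be indexed over one fixed output space. -/
theorem Step.env_eq {ψ : Hilb Γ} {v : Value X} (s : Step Γ S ψ v) (d : Typing Γ S Δ) :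
    v.env = Δ := by
  induction s generalizing Δ with
  | skip => cases d; rfl
  | newQbit => cases d; rfl
  | discard₀ => cases d; rfl
  | discard₁ => cases d; rfl
  | gate => cases d; rfl
  | seq _ _ h₀ h₁ =>
    cases d with
    | seq d₀ d₁ => obtain rfl := h₀ d₀; exact h₁ d₁
  | meas₀ _ _ h => cases d with | meas _ d₀ d₁ => exact h d₀
  | meas₁ _ _ h => cases d with | meas _ d₀ d₁ => exact h d₁
  | whileDo₀ => cases d; rfl
  -- The premise concerns the larger statement `S; while`, so the induction has to run on the
  -- transition derivation and the typing is rebuilt here.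
  | whileDo₁ _ _ h => cases d with | whileDo hq d => exact h (.seq d (.whileDo hq d))
  | qcase _ _ _ h₀ _ =>
    cases d with
    | qcase _ _ _ d₀ d₁ => obtain rfl := h₀ d₀; rfl

/-- The derivations of transitions from `[S, |ψ⟩]_Γ` with output environment `Δ`. -/
abbrev Deriv (Γ : Finset X) (S : Stmt X) (ψ : Hilb Γ) (Δ : Finset X) : Type u :=
  Σ p : Hilb Δ × Bool, Step Γ S ψ ⟨Δ, p.1, p.2⟩

/-- `skip` has one derivation. -/
noncomputable def Deriv.skipEquiv (ψ : Hilb Γ) : Unit ≃ Deriv Γ .skip ψ Γ where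
  toFun _ := ⟨(ψ, true), .skip⟩
  invFun _ := ()
  left_inv _ := rfl
  right_inv := by rintro ⟨⟨φ, ν⟩, s⟩; cases s; rfl

/-- `new qbit q` has one derivation. -/
noncomputable def Deriv.newQbitEquiv (hq : q ∉ Γ) (ψ : Hilb Γ) :
    Unit ≃ Deriv Γ (.newQbit q) ψ (insert q Γ) where
  toFun _ := ⟨((ket q 0 Γ (insert q Γ)).act ψ, true), .newQbit hq⟩
  invFun _ := ()
  left_inv _ := rfl
  right_inv := by rintro ⟨⟨φ, ν⟩, s⟩; cases s; rfl

/-- `q *= U` has one derivation. -/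
noncomputable def Deriv.gateEquiv (hq : q ∈ Γ) (U : Matrix.unitaryGroup (Fin 2) ℂ) (ψ : Hilb Γ) :
    Unit ≃ Deriv Γ (.gate q U) ψ Γ where
  toFun _ := ⟨((gateOp q U.1 Γ).act ψ, true), .gate hq⟩
  invFun _ := ()
  left_inv _ := rfl
  right_inv := by rintro ⟨⟨φ, ν⟩, s⟩; cases s; rfl

/-- `discard q` has two derivations. -/
noncomputable def Deriv.discardEquiv (hq : q ∈ Γ) (ψ : Hilb Γ) :
    Unit ⊕ Unit ≃ Deriv Γ (.discard q) ψ (Γ.erase q) where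
  toFun
    | .inl _ => ⟨((bra q 0 Γ (Γ.erase q)).act ψ, true), .discard₀ hq⟩
    | .inr _ => ⟨((bra q 1 Γ (Γ.erase q)).act ψ, false), .discard₁ hq⟩
  invFun x := if x.1.2 then .inl () else .inr ()
  left_inv x := by rcases x with x | x <;> rfl
  right_inv := by rintro ⟨⟨φ, ν⟩, s⟩; cases s <;> rfl

/-- Derivations of a sequence are pairs of derivations. -/
noncomputable def Deriv.seqEquiv' (ψ : Hilb Γ) :
    (Σ Γ' : Finset X, Σ x : Deriv Γ S₀ ψ Γ', Deriv Γ' S₁ x.1.1 Δ) ≃ Deriv Γ (.seq S₀ S₁) ψ Δ where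
  toFun x := ⟨(x.2.2.1.1, x.2.1.1.2 && x.2.2.1.2), .seq x.2.1.2 x.2.2.2⟩
  invFun := by
    rintro ⟨⟨φ, ν⟩, s⟩
    cases s with
    | @seq _ Γ' _ _ _ _ ψ' _ ν μ s₀ s₁ => exact ⟨Γ', ⟨(ψ', ν), s₀⟩, ⟨(φ, μ), s₁⟩⟩
  left_inv x := rfl
  right_inv := by rintro ⟨⟨φ, ν⟩, s⟩; cases s; rfl

/-- Derivations of a measurement are those of either branch. -/
noncomputable def Deriv.measEquiv (hq : q ∈ Γ) (ψ : Hilb Γ) :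
    Deriv Γ S₀ ((proj q 0 Γ).act ψ) Δ ⊕ Deriv Γ S₁ ((proj q 1 Γ).act ψ) Δ ≃
      Deriv Γ (.meas q S₀ S₁) ψ Δ where
  toFun
    | .inl x => ⟨x.1, .meas₀ hq x.2⟩
    | .inr x => ⟨(x.1.1, false), .meas₁ hq x.2⟩
  invFun := by
    rintro ⟨⟨φ, ν⟩, s⟩
    cases s with
    | meas₀ _ s => exact .inl ⟨(φ, ν), s⟩
    | @meas₁ _ _ _ _ _ _ _ ν _ s => exact .inr ⟨(φ, ν), s⟩
  left_inv x := by rcases x with x | x <;> rfl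
  right_inv := by rintro ⟨⟨φ, ν⟩, s⟩; cases s <;> rfl

/-- A loop either stops or unfolds once. -/
noncomputable def Deriv.whileEquiv' (hq : q ∈ Γ) (ψ : Hilb Γ) :
    Unit ⊕ Deriv Γ (.seq S (.whileDo q S)) ((proj q 1 Γ).act ψ) Γ ≃
      Deriv Γ (.whileDo q S) ψ Γ where
  toFun
    | .inl _ => ⟨((proj q 0 Γ).act ψ, true), .whileDo₀ hq⟩
    | .inr x => ⟨(x.1.1, false), .whileDo₁ hq x.2⟩
  invFun := by
    rintro ⟨⟨φ, ν⟩, s⟩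
    cases s with
    | whileDo₀ _ => exact .inl ()
    | @whileDo₁ _ _ _ _ _ _ ν _ s => exact .inr ⟨(φ, ν), s⟩
  left_inv x := by rcases x with x | x <;> rfl
  right_inv := by rintro ⟨⟨φ, ν⟩, s⟩; cases s <;> rfl

/-- Derivations of a quantum case are pairs of derivations. -/
noncomputable def Deriv.qcaseEquiv' (hq : q ∈ Γ) (ψ : Hilb Γ) :
    (Σ Γ' : {Γ' : Finset X // insert q Γ' = Δ},
      Deriv (Γ.erase q) S₀ ((bra q 0 Γ (Γ.erase q)).act ψ) Γ'.1 ×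
        Deriv (Γ.erase q) S₁ ((bra q 1 Γ (Γ.erase q)).act ψ) Γ'.1) ≃
      Deriv Γ (.qcase q S₀ S₁) ψ Δ where
  toFun
    | ⟨⟨Γ', h⟩, x, y⟩ =>
      h ▸ ⟨(bitC y.1.2 • (ket q 0 Γ' (insert q Γ')).act x.1.1 +
          bitC x.1.2 • (ket q 1 Γ' (insert q Γ')).act y.1.1, x.1.2 && y.1.2),
        .qcase hq x.2 y.2⟩
  invFun := by
    rintro ⟨⟨φ, ν⟩, s⟩
    cases s with
    | @qcase _ Γ' _ _ _ _ ψ₀ ψ₁ ν₀ ν₁ _ s₀ s₁ =>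
      exact ⟨⟨Γ', rfl⟩, ⟨(ψ₀, ν₀), s₀⟩, ⟨(ψ₁, ν₁), s₁⟩⟩
  left_inv := by rintro ⟨⟨Γ', rfl⟩, x, y⟩; rfl
  right_inv := by rintro ⟨⟨φ, ν⟩, s⟩; cases s; rfl

/-- The number of rules used in a derivation. -/
noncomputable def Step.size : {Γ : Finset X} → {S : Stmt X} → {ψ : Hilb Γ} → {v : Value X} →
    Step Γ S ψ v → ℕ
  | _, _, _, _, .skip => 0
  | _, _, _, _, .newQbit _ => 0
  | _, _, _, _, .discard₀ _ => 0
  | _, _, _, _, .discard₁ _ => 0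
  | _, _, _, _, .gate _ => 0
  | _, _, _, _, .seq s₀ s₁ => s₀.size + s₁.size + 1
  | _, _, _, _, .meas₀ _ s => s.size + 1
  | _, _, _, _, .meas₁ _ s => s.size + 1
  | _, _, _, _, .whileDo₀ _ => 0
  | _, _, _, _, .whileDo₁ _ s => s.size + 1
  | _, _, _, _, .qcase _ s₀ s₁ => s₀.size + s₁.size + 1

/-- If `S₀` is well formed, the intermediate environment is unique. -/
noncomputable def Deriv.seqEquiv {Γ' : Finset X} (d : Typing Γ S₀ Γ') (ψ : Hilb Γ) :
    (Σ x : Deriv Γ S₀ ψ Γ', Deriv Γ' S₁ x.1.1 Δ) ≃ Deriv Γ (.seq S₀ S₁) ψ Δ :=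
  (Equiv.ofBijective (fun x => ⟨Γ', x⟩)
    ⟨fun x y h => by cases h; rfl, by
      rintro ⟨Γ'', x⟩; obtain rfl := x.1.2.env_eq d; exact ⟨x, rfl⟩⟩).trans
    (Deriv.seqEquiv' ψ)

theorem Deriv.seqEquiv_apply {Γ' : Finset X} (d : Typing Γ S₀ Γ') (ψ : Hilb Γ)
    (x : Σ x : Deriv Γ S₀ ψ Γ', Deriv Γ' S₁ x.1.1 Δ) :
    Deriv.seqEquiv d ψ x = ⟨(x.2.1.1, x.1.1.2 && x.2.1.2), .seq x.1.2 x.2.2⟩ := rfl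

/-- For a well-formed body, a loop either stops or runs the body once and starts again. -/
noncomputable def Deriv.whileEquiv (hq : q ∈ Γ) (d : Typing Γ S Γ) (ψ : Hilb Γ) :
    Unit ⊕ (Σ x : Deriv Γ S ((proj q 1 Γ).act ψ) Γ, Deriv Γ (.whileDo q S) x.1.1 Γ) ≃
      Deriv Γ (.whileDo q S) ψ Γ :=
  (Equiv.sumCongr (Equiv.refl Unit) (Deriv.seqEquiv d _)).trans (Deriv.whileEquiv' hq ψ)

/-- If the branches are well formed, their output environment is unique. -/
noncomputable def Deriv.qcaseEquiv (hq : q ∈ Γ) (d : Typing (Γ.erase q) S₀ Δ) (ψ : Hilb Γ) :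
    Deriv (Γ.erase q) S₀ ((bra q 0 Γ (Γ.erase q)).act ψ) Δ ×
      Deriv (Γ.erase q) S₁ ((bra q 1 Γ (Γ.erase q)).act ψ) Δ ≃
      Deriv Γ (.qcase q S₀ S₁) ψ (insert q Δ) :=
  (Equiv.ofBijective (fun x => ⟨⟨Δ, rfl⟩, x⟩)
    ⟨fun x y h => by cases h; rfl, by
      rintro ⟨⟨Γ'', h⟩, x⟩
      dsimp only at x
      obtain rfl := x.1.2.env_eq d; exact ⟨x, rfl⟩⟩).trans
    (Deriv.qcaseEquiv' hq ψ)

theorem Deriv.qcaseEquiv_apply (hq : q ∈ Γ) (d : Typing (Γ.erase q) S₀ Δ) (ψ : Hilb Γ)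
    (x : Deriv (Γ.erase q) S₀ ((bra q 0 Γ (Γ.erase q)).act ψ) Δ ×
      Deriv (Γ.erase q) S₁ ((bra q 1 Γ (Γ.erase q)).act ψ) Δ) :
    Deriv.qcaseEquiv hq d ψ x =
      ⟨(bitC x.2.1.2 • (ket q 0 Δ (insert q Δ)).act x.1.1.1 +
          bitC x.1.1.2 • (ket q 1 Δ (insert q Δ)).act x.2.1.1, x.1.1.2 && x.2.1.2),
        .qcase hq x.1.2 x.2.2⟩ := rfl

/-- All the derivations from a well-formed statement. -/
noncomputable def Deriv.sigmaEquiv (d : Typing Γ S Δ) (ψ : Hilb Γ) :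
    Deriv Γ S ψ Δ ≃ Σ v : Value X, Step Γ S ψ v :=
  Equiv.ofBijective (fun x => ⟨⟨Δ, x.1.1, x.1.2⟩, x.2⟩) (by
    constructor
    · rintro ⟨⟨φ, ν⟩, s⟩ ⟨⟨φ', ν'⟩, s'⟩ h
      cases h
      rfl
    · rintro ⟨⟨Δ', φ, ν⟩, s⟩
      obtain rfl : Δ' = Δ := s.env_eq d
      exact ⟨⟨(φ, ν), s⟩, rfl⟩)

end Deriv

/-! ### The derivation without nontrivial branching -/

/-! ### Operators acting on vectors and on rank-one operators -/

section Act

theorem posSemidef_pure {X : Type u} {Γ : Finset X} (ψ : Hilb Γ) : (pure ψ).PosSemidef :=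
  Matrix.posSemidef_vecMulVec_self_star _

theorem pure_zero {X : Type u} {Γ : Finset X} : pure (0 : Hilb Γ) = 0 := by
  simp [pure]

variable {X : Type u} [DecidableEq X] {Γ Δ Γ' : Finset X}

theorem Op.act_mul (M : Op Γ' Δ) (N : Op Γ Γ') (ψ : Hilb Γ) :
    Op.act (M * N : Op Γ Δ) ψ = M.act (N.act ψ) := by
  simp [Op.act, Matrix.mulVec_mulVec]

theorem Op.act_add (M N : Op Γ Δ) (ψ : Hilb Γ) :
    Op.act (M + N : Op Γ Δ) ψ = M.act ψ + N.act ψ := by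
  simp [Op.act, Matrix.add_mulVec]

theorem Op.act_one (ψ : Hilb Γ) : Op.act (1 : Op Γ Γ) ψ = ψ := by
  simp [Op.act]

theorem pure_act (K : Op Γ Δ) (ψ : Hilb Γ) : pure (K.act ψ) = conjBy K (pure ψ) := by
  simp only [pure, Op.act, conjBy_apply]
  rw [Matrix.mul_vecMulVec, Matrix.vecMulVec_mul, Matrix.star_mulVec]

theorem trace_pure (ψ : Hilb Γ) : (pure ψ).trace = ((‖ψ‖ ^ 2 : ℝ) : ℂ) := by
  rw [EuclideanSpace.norm_sq_eq, pure, Matrix.trace_vecMulVec]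
  simp [dotProduct, Complex.mul_conj, Complex.normSq_eq_norm_sq]

end Act

section TrueDeriv

variable {X : Type u} [DecidableEq X] {Γ Δ : Finset X} {S : Stmt X}

theorem denote_whileDo_snd {q : X} (hq : q ∈ Γ) (d : Typing Γ S Γ) :
    (denote (.whileDo hq d)).2 = proj q 0 Γ := by
  obtain ⟨L, h, -⟩ := lfp_loop hq (Den.Regular.denote d)
  rw [denote, h]

/-- There is exactly one derivation ending in a value with bit one, and the state of this value is
given by the transformation matrix of the denotation. -/
theorem exists_unique_true_deriv (d : Typing Γ S Δ) (ψ : Hilb Γ) :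
    ∃ x : Deriv Γ S ψ Δ, x.1 = ((denote d).2.act ψ, true) ∧
      ∀ y : Deriv Γ S ψ Δ, y.1.2 = true → y = x := by
  induction d with
  | skip =>
    refine ⟨Deriv.skipEquiv ψ (), Prod.ext (Op.act_one ψ).symm rfl, fun y _ => ?_⟩
    obtain ⟨z, rfl⟩ := (Deriv.skipEquiv ψ).surjective y
    rfl
  | newQbit hq =>
    refine ⟨Deriv.newQbitEquiv hq ψ (), rfl, fun y _ => ?_⟩
    obtain ⟨z, rfl⟩ := (Deriv.newQbitEquiv hq ψ).surjective y
    rfl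
  | discard hq =>
    refine ⟨Deriv.discardEquiv hq ψ (.inl ()), rfl, fun y hy => ?_⟩
    obtain ⟨z | z, rfl⟩ := (Deriv.discardEquiv hq ψ).surjective y
    · rfl
    · exact absurd hy Bool.false_ne_true
  | gate hq =>
    refine ⟨Deriv.gateEquiv hq _ ψ (), rfl, fun y _ => ?_⟩
    obtain ⟨z, rfl⟩ := (Deriv.gateEquiv hq _ ψ).surjective y
    rfl
  | seq d₀ d₁ h₀ h₁ =>
    obtain ⟨x₀, hx₀, hu₀⟩ := h₀ ψ
    obtain ⟨x₁, hx₁, hu₁⟩ := h₁ x₀.1.1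
    refine ⟨Deriv.seqEquiv d₀ ψ ⟨x₀, x₁⟩, ?_, fun y hy => ?_⟩
    · rw [Deriv.seqEquiv_apply]
      simp only [hx₁, Bool.and_true]
      rw [hx₀, denote, Den.comp, Op.act_mul]
    · obtain ⟨⟨a, b⟩, rfl⟩ := (Deriv.seqEquiv d₀ ψ).surjective y
      rw [Deriv.seqEquiv_apply] at hy
      -- A product of bits is one only if both factors are, so each half must be the distinguished
      -- derivation.
      obtain ⟨ha, hb⟩ := (Bool.and_eq_true _ _).mp hy
      obtain rfl := hu₀ a ha
      obtain rfl := hu₁ b hb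
      rfl
  | @meas Γ Γ' q S₀ S₁ hq d₀ d₁ h₀ h₁ =>
    obtain ⟨x₀, hx₀, hu₀⟩ := h₀ ((proj q 0 Γ).act ψ)
    refine ⟨Deriv.measEquiv hq ψ (.inl x₀), ?_, fun y hy => ?_⟩
    · change x₀.1 = _
      rw [hx₀, denote, Den.meas, Op.act_mul]
    · obtain ⟨a | a, rfl⟩ := (Deriv.measEquiv hq ψ).surjective y
      · obtain rfl := hu₀ a hy
        rfl
      · exact absurd hy Bool.false_ne_true
  | whileDo hq d h =>
    refine ⟨Deriv.whileEquiv hq d ψ (.inl ()), ?_, fun y hy => ?_⟩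
    · rw [denote_whileDo_snd]
      rfl
    · obtain ⟨a | a, rfl⟩ := (Deriv.whileEquiv hq d ψ).surjective y
      · rfl
      · exact absurd hy Bool.false_ne_true
  | @qcase Γ Γ' q S₀ S₁ hq hq' hv d₀ d₁ h₀ h₁ =>
    obtain ⟨x₀, hx₀, hu₀⟩ := h₀ ((bra q 0 Γ (Γ.erase q)).act ψ)
    obtain ⟨x₁, hx₁, hu₁⟩ := h₁ ((bra q 1 Γ (Γ.erase q)).act ψ)
    refine ⟨Deriv.qcaseEquiv hq d₀ ψ ⟨x₀, x₁⟩, ?_, fun y hy => ?_⟩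
    · rw [Deriv.qcaseEquiv_apply]
      simp only [hx₀, hx₁, bitC, if_true, one_smul, Bool.and_true, denote, Den.qcase, Op.act_add,
        Op.act_mul]
    · obtain ⟨⟨a, b⟩, rfl⟩ := (Deriv.qcaseEquiv hq d₀ ψ).surjective y
      rw [Deriv.qcaseEquiv_apply] at hy
      obtain ⟨ha, hb⟩ := (Bool.and_eq_true _ _).mp hy
      obtain rfl := hu₀ a ha
      obtain rfl := hu₁ b hb
      rfl

end TrueDeriv

/-! ### Sums over derivations -/

theorem tsum_sum_type {α β : Type*} (f : α ⊕ β → ENNReal) :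
    ∑' x, f x = ∑' a, f (.inl a) + ∑' b, f (.inr b) :=
  (HasSum.sum (ENNReal.summable (f := f ∘ Sum.inl)).hasSum
    (ENNReal.summable (f := f ∘ Sum.inr)).hasSum).tsum_eq

/-- The family is supported on the row and the column through (a, b). This is the pattern of pairs
of derivations in a quantum case. -/
theorem tsum_prod_of_cross {α β : Type*} (t : α × β → ENNReal) (a : α) (b : β)
    [∀ x, Decidable (x = a)] [∀ y, Decidable (y = b)] (h : ∀ x y, x ≠ a → y ≠ b → t (x, y) = 0) :
    ∑' p, t p = t (a, b) + (∑' x, if x = a then 0 else t (x, b)) +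
      ∑' y, if y = b then 0 else t (a, y) := by
  rw [ENNReal.tsum_prod', ENNReal.tsum_eq_add_tsum_ite a, ENNReal.tsum_eq_add_tsum_ite b, add_assoc,
    add_assoc, add_comm (∑' x, _)]
  congr 2
  · refine tsum_congr fun x => ?_
    by_cases hx : x = a
    · rw [if_pos hx, if_pos hx]
    · rw [if_neg hx, if_neg hx]
      exact tsum_eq_single b fun y hy => h x y hx hy
  · exact tsum_congr fun y => by split_ifs <;> rfl

/-! ### Positive functionals -/

section PosFunctional

variable {A B : Type u}

/-- Linear functionals with nonnegative real part on positive semidefinite matrices. -/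
def IsPosFunctional (l : Matrix A A ℂ →ₗ[ℂ] ℂ) : Prop :=
  ∀ ρ : Matrix A A ℂ, ρ.PosSemidef → 0 ≤ (l ρ).re

theorem IsPosFunctional.comp {l : Matrix B B ℂ →ₗ[ℂ] ℂ} (hl : IsPosFunctional l)
    {C : Superop A B} (hC : IsCP C) : IsPosFunctional (l ∘ₗ C) :=
  fun _ hρ => hl _ (hC.posSemidef hρ)

theorem isPosFunctional_trace [Fintype A] : IsPosFunctional (Matrix.traceLinearMap A ℂ ℂ) :=
  fun _ hρ => PosSemidef.trace_re_nonneg hρ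

theorem IsPosFunctional.ofReal_add {l : Matrix A A ℂ →ₗ[ℂ] ℂ} (hl : IsPosFunctional l)
    {ρ σ : Matrix A A ℂ} (hρ : ρ.PosSemidef) (hσ : σ.PosSemidef) :
    ENNReal.ofReal (l (ρ + σ)).re = ENNReal.ofReal (l ρ).re + ENNReal.ofReal (l σ).re := by
  rw [map_add, Complex.add_re, ENNReal.ofReal_add (hl _ hρ) (hl _ hσ)]

end PosFunctional

/-! ### Ensembles average to denotations -/

section Sum

variable {X : Type u} [DecidableEq X] {Γ Δ : Finset X} {S : Stmt X}

/-- The ensemble of a well-formed statement averages to its denotation. -/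
def SumsTo (Γ : Finset X) (S : Stmt X) (C : Superop (BasisIdx Γ) (BasisIdx Δ)) : Prop :=
  ∀ (ψ : Hilb Γ) (l : Op Δ Δ →ₗ[ℂ] ℂ), IsPosFunctional l →
    ∑' x : Deriv Γ S ψ Δ, ENNReal.ofReal (l (pure x.1.1)).re =
      ENNReal.ofReal (l (C (pure ψ))).re

/-- The hypothesis on S₀ is used with l ∘ C₁ in place of l; this is why `SumsTo` quantifies over
functionals. -/
theorem SumsTo.seq {Γ' : Finset X} {S₀ S₁ : Stmt X} {C₀ : Superop (BasisIdx Γ) (BasisIdx Γ')}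
    {C₁ : Superop (BasisIdx Γ') (BasisIdx Δ)} (d₀ : Typing Γ S₀ Γ') (hC₁ : IsCP C₁)
    (h₀ : SumsTo Γ S₀ C₀) (h₁ : SumsTo Γ' S₁ C₁) : SumsTo Γ (.seq S₀ S₁) (C₁ ∘ₗ C₀) := by
  intro ψ l hl
  rw [← (Deriv.seqEquiv d₀ ψ).tsum_eq, ENNReal.tsum_sigma']
  simp only [Deriv.seqEquiv_apply]
  have h := h₀ ψ (l ∘ₗ C₁) (hl.comp hC₁)
  simp only [LinearMap.comp_apply] at h ⊢
  rw [← h]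
  exact tsum_congr fun x => h₁ x.1.1 l hl

theorem SumsTo.meas {q : X} {S₀ S₁ : Stmt X} {C₀ C₁ : Superop (BasisIdx Γ) (BasisIdx Δ)}
    (hq : q ∈ Γ) (hC₀ : IsCP C₀) (hC₁ : IsCP C₁) (h₀ : SumsTo Γ S₀ C₀) (h₁ : SumsTo Γ S₁ C₁) :
    SumsTo Γ (.meas q S₀ S₁) (C₀ ∘ₗ conjBy (proj q 0 Γ) + C₁ ∘ₗ conjBy (proj q 1 Γ)) := by
  intro ψ l hl
  rw [← (Deriv.measEquiv hq ψ).tsum_eq, tsum_sum_type, LinearMap.add_apply, LinearMap.comp_apply,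
    LinearMap.comp_apply, ← pure_act, ← pure_act,
    hl.ofReal_add (hC₀.posSemidef (posSemidef_pure _)) (hC₁.posSemidef (posSemidef_pure _)),
    ← h₀ _ l hl, ← h₁ _ l hl]
  rfl

theorem tsum_deriv_whileDo {q : X} (hq : q ∈ Γ) (d : Typing Γ S Γ) (ψ : Hilb Γ)
    (g : Deriv Γ (.whileDo q S) ψ Γ → ENNReal) :
    ∑' x, g x = g ⟨((proj q 0 Γ).act ψ, true), .whileDo₀ hq⟩ +
      ∑' x : Deriv Γ S ((proj q 1 Γ).act ψ) Γ, ∑' y : Deriv Γ (.whileDo q S) x.1.1 Γ,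
        g ⟨(y.1.1, false), .whileDo₁ hq (.seq x.2 y.2)⟩ := by
  rw [← (Deriv.whileEquiv hq d ψ).tsum_eq, tsum_sum_type, ENNReal.tsum_sigma', tsum_fintype,
    Finset.univ_unique, Finset.sum_singleton]
  rfl

/-- The denotational counterpart of `tsum_deriv_whileDo`. Since L is any completely positive map, it
serves both the limit and the iterates. -/
theorem SumsTo.apply_whileDo {q : X} {C L : Superop (BasisIdx Γ) (BasisIdx Γ)}
    (h : SumsTo Γ S C) (hC : IsCP C) (hL : IsCP L) (ψ : Hilb Γ) {l : Op Γ Γ →ₗ[ℂ] ℂ}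
    (hl : IsPosFunctional l) :
    ENNReal.ofReal (l ((conjBy (proj q 0 Γ) + (L ∘ₗ C) ∘ₗ conjBy (proj q 1 Γ)) (pure ψ))).re =
      ENNReal.ofReal (l (pure ((proj q 0 Γ).act ψ))).re +
        ∑' x : Deriv Γ S ((proj q 1 Γ).act ψ) Γ, ENNReal.ofReal (l (L (pure x.1.1))).re := by
  rw [LinearMap.add_apply, LinearMap.comp_apply, ← pure_act, ← pure_act, hl.ofReal_add
    (posSemidef_pure _) ((hL.comp hC).posSemidef (posSemidef_pure _))]
  exact congrArg _ (h _ (l ∘ₗ L) (hl.comp hL)).symm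

theorem SumsTo.whileDo {q : X} (hq : q ∈ Γ) (d : Typing Γ S Γ)
    {C L : Superop (BasisIdx Γ) (BasisIdx Γ)} (hC : IsCP C) (hL : IsCP L) (h : SumsTo Γ S C)
    (hlim : ∀ ρ, Tendsto (fun k => loopIter q C k ρ) atTop (𝓝 (L ρ)))
    (hfix : L = conjBy (proj q 0 Γ) + (L ∘ₗ C) ∘ₗ conjBy (proj q 1 Γ)) :
    SumsTo Γ (.whileDo q S) L := by
  intro ψ l hl
  refine le_antisymm ?_ ?_
  -- Upper bound: induct on a size cutoff, unfolding the sum and the fixed-point equation for L in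
  -- parallel.
  · have key : ∀ k (ψ : Hilb Γ), (∑' x : Deriv Γ (.whileDo q S) ψ Γ,
        if x.2.size < k then ENNReal.ofReal (l (pure x.1.1)).re else 0) ≤
          ENNReal.ofReal (l (L (pure ψ))).re := by
      intro k
      induction k with
      | zero => intro ψ; simp
      | succ k ih =>
        intro ψ
        conv_rhs => rw [hfix, h.apply_whileDo hC hL ψ hl]
        rw [tsum_deriv_whileDo hq d]
        refine add_le_add ?_ (ENNReal.tsum_le_tsum fun x => le_trans ?_ (ih x.1.1))
        · split_ifs <;> simp
        · refine ENNReal.tsum_le_tsum fun y => ?_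
          by_cases hy : y.2.size < k
          · rw [if_pos hy]
            split_ifs <;> simp
          · rw [if_neg (by simp only [Step.size]; omega)]
            exact zero_le
    -- A finite set of derivations has bounded size, so every partial sum lies below some truncated
    -- sum.
    rw [ENNReal.tsum_eq_iSup_sum]
    refine iSup_le fun s => le_trans ?_ (key (s.sup (fun x => x.2.size) + 1) ψ)
    refine le_trans (Finset.sum_le_sum fun x hx => ?_) (ENNReal.sum_le_tsum s)
    rw [if_pos (Nat.lt_succ_of_le (Finset.le_sup (f := fun x => x.2.size) hx))]
  -- Lower bound: the same unfolding with iterates, followed by passage to the limit.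
  · have key : ∀ k (ψ : Hilb Γ), ENNReal.ofReal (l (loopIter q C k (pure ψ))).re ≤
        ∑' x : Deriv Γ (.whileDo q S) ψ Γ, ENNReal.ofReal (l (pure x.1.1)).re := by
      intro k
      induction k with
      | zero => intro ψ; simp [loopIter]
      | succ k ih =>
        intro ψ
        rw [loopIter, h.apply_whileDo hC (isCP_loopIter hC k) ψ hl, tsum_deriv_whileDo hq d]
        exact add_le_add le_rfl (ENNReal.tsum_le_tsum fun x => ih x.1.1)
    have hc : Continuous fun ρ : Op Γ Γ => ENNReal.ofReal (l ρ).re :=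
      ENNReal.continuous_ofReal.comp
        (Complex.continuous_re.comp l.continuous_of_finiteDimensional)
    exact le_of_tendsto' ((hc.tendsto _).comp (hlim (pure ψ))) fun k => key k ψ

/-- Removing the derivation with bit one. -/
theorem SumsTo.tsum_ite {ψ : Hilb Γ} {x : Den Γ Δ} (h : SumsTo Γ S x.1) (hx : x.Regular)
    {a : Deriv Γ S ψ Δ} [∀ y, Decidable (y = a)] (ha : a.1.1 = x.2.act ψ)
    {l : Op Δ Δ →ₗ[ℂ] ℂ} (hl : IsPosFunctional l) :
    (∑' y : Deriv Γ S ψ Δ, if y = a then 0 else ENNReal.ofReal (l (pure y.1.1)).re) =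
      ENNReal.ofReal (l ((x.1 - conjBy x.2) (pure ψ))).re := by
  have h1 := h ψ l hl
  have h2 : x.1 (pure ψ) = pure a.1.1 + (x.1 - conjBy x.2) (pure ψ) := by
    rw [ha, pure_act, LinearMap.sub_apply, add_sub_cancel]
  rw [h2, hl.ofReal_add (posSemidef_pure _) (hx.isCP_sub.posSemidef (posSemidef_pure _)),
    ENNReal.tsum_eq_add_tsum_ite a] at h1
  -- Cancelling in `ENNReal` is legitimate because the removed term is finite.
  rw [← (ENNReal.add_right_inj ENNReal.ofReal_ne_top).1 h1]
  exact tsum_congr fun y => by split_ifs <;> rfl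

/-- Pairs of derivations form a cross centred at the two bit-one derivations a and b. The centre
gives the coherent term of `Den.qcase_fst_eq`, and the two arms give the remainders. -/
theorem SumsTo.qcase {q : X} {S₀ S₁ : Stmt X} (hq : q ∈ Γ) (d₀ : Typing (Γ.erase q) S₀ Δ)
    (d₁ : Typing (Γ.erase q) S₁ Δ) (h₀ : SumsTo (Γ.erase q) S₀ (denote d₀).1)
    (h₁ : SumsTo (Γ.erase q) S₁ (denote d₁).1) :
    SumsTo Γ (.qcase q S₀ S₁) (Den.qcase q (denote d₀) (denote d₁)).1 := by
  classical
  intro ψ l hl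
  obtain ⟨a, ha, hau⟩ := exists_unique_true_deriv d₀ ((bra q 0 Γ (Γ.erase q)).act ψ)
  obtain ⟨b, hb, hbu⟩ := exists_unique_true_deriv d₁ ((bra q 1 Γ (Γ.erase q)).act ψ)
  have hau' : ∀ x, x ≠ a → x.1.2 = false := fun x hx => by
    by_contra h; exact hx (hau x (by simpa using h))
  have hbu' : ∀ y, y ≠ b → y.1.2 = false := fun y hy => by
    by_contra h; exact hy (hbu y (by simpa using h))
  have e₀ := h₀.tsum_ite (Den.Regular.denote d₀) (a := a) (congrArg Prod.fst ha)
    (hl.comp (IsCP.conjBy (ket q 0 Δ (insert q Δ))))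
  have e₁ := h₁.tsum_ite (Den.Regular.denote d₁) (a := b) (congrArg Prod.fst hb)
    (hl.comp (IsCP.conjBy (ket q 1 Δ (insert q Δ))))
  have r₀ := (Den.Regular.denote d₀).isCP_sub
  have r₁ := (Den.Regular.denote d₁).isCP_sub
  simp only [LinearMap.comp_apply, ← pure_act] at e₀ e₁
  rw [Den.qcase_fst_eq, LinearMap.add_apply, LinearMap.add_apply,
    hl.ofReal_add (((IsCP.conjBy _).posSemidef (posSemidef_pure _)).add
      (((IsCP.conjBy _).comp (r₀.comp (IsCP.conjBy _))).posSemidef (posSemidef_pure _)))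
      (((IsCP.conjBy _).comp (r₁.comp (IsCP.conjBy _))).posSemidef (posSemidef_pure _)),
    hl.ofReal_add ((IsCP.conjBy _).posSemidef (posSemidef_pure _))
      (((IsCP.conjBy _).comp (r₀.comp (IsCP.conjBy _))).posSemidef (posSemidef_pure _))]
  simp only [LinearMap.comp_apply, ← pure_act]
  rw [← e₀, ← e₁, ← (Deriv.qcaseEquiv hq d₀ ψ).tsum_eq, tsum_prod_of_cross _ a b]
  · congr 1
    · congr 1
      · simp only [Deriv.qcaseEquiv_apply, ha, hb, bitC, if_true, one_smul, Den.qcase, Op.act_add,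
          Op.act_mul]
      · refine tsum_congr fun x => ?_
        split_ifs with hx
        · rfl
        · simp [Deriv.qcaseEquiv_apply, hb, bitC, hau' x hx]
    · refine tsum_congr fun y => ?_
      split_ifs with hy
      · rfl
      · simp [Deriv.qcaseEquiv_apply, ha, bitC, hbu' y hy]
  -- Off the cross both bits are zero, hence both amplitudes vanish.
  · intro x y hx hy
    simp [Deriv.qcaseEquiv_apply, bitC, hau' x hx, hbu' y hy, pure_zero]

theorem sumsTo_denote (d : Typing Γ S Δ) : SumsTo Γ S (denote d).1 := by
  induction d with
  | skip =>
    intro ψ l _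
    rw [← (Deriv.skipEquiv ψ).tsum_eq, tsum_fintype, Finset.univ_unique, Finset.sum_singleton]
    rfl
  | newQbit hq =>
    intro ψ l _
    rw [← (Deriv.newQbitEquiv hq ψ).tsum_eq, tsum_fintype, Finset.univ_unique,
      Finset.sum_singleton, denote, ← pure_act]
    rfl
  | discard hq =>
    intro ψ l hl
    rw [← (Deriv.discardEquiv hq ψ).tsum_eq, tsum_sum_type, tsum_fintype, tsum_fintype,
      Finset.univ_unique, Finset.sum_singleton, Finset.sum_singleton, denote,
      LinearMap.add_apply, ← pure_act, ← pure_act,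
      hl.ofReal_add (posSemidef_pure _) (posSemidef_pure _)]
    rfl
  | gate hq =>
    intro ψ l _
    rw [← (Deriv.gateEquiv hq _ ψ).tsum_eq, tsum_fintype, Finset.univ_unique,
      Finset.sum_singleton, denote, ← pure_act]
    rfl
  | seq d₀ d₁ h₀ h₁ => exact h₀.seq d₀ (Den.Regular.denote d₁).isCP h₁
  | meas hq d₀ d₁ h₀ h₁ =>
    exact h₀.meas hq (Den.Regular.denote d₀).isCP (Den.Regular.denote d₁).isCP h₁
  | whileDo hq d h =>
    obtain ⟨L, h1, hlim, hfix, hreg⟩ := lfp_loop hq (Den.Regular.denote d)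
    rw [denote, h1]
    exact h.whileDo hq d (Den.Regular.denote d).isCP hreg.isCP hlim hfix
  | qcase hq _ _ d₀ d₁ h₀ h₁ => exact h₀.qcase hq d₀ d₁ h₁

end Sum

/-! ### Multiplicities and the total mass of the ensemble -/

section Termination

variable {X : Type u} [DecidableEq X] {Γ Δ : Finset X} {S : Stmt X}

theorem tsum_step_norm_sq (d : Typing Γ S Δ) (ψ : Hilb Γ) :
    ∑' v : Value X, ∑' _ : Step Γ S ψ v, ENNReal.ofReal (‖v.state‖ ^ 2) =
      ENNReal.ofReal ((denote d).1 (pure ψ)).trace.re := by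
  have h := sumsTo_denote d ψ _ isPosFunctional_trace
  simp only [Matrix.traceLinearMap_apply, trace_pure, Complex.ofReal_re] at h
  rw [← h, ← ENNReal.tsum_sigma fun (v : Value X) (_ : Step Γ S ψ v) =>
    ENNReal.ofReal (‖v.state‖ ^ 2), ← (Deriv.sigmaEquiv d ψ).tsum_eq]
  rfl

/-- Infinitely many derivations of a value with nonzero state would give infinite total mass. A zero
state with bit one falls under `exists_unique_true_deriv`. -/
theorem finite_step (d : Typing Γ S Δ) (ψ : Hilb Γ) {v : Value X} (hv : ¬ v.IsTrivial) :
    Finite (Step Γ S ψ v) := by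
  by_contra hinf
  rw [not_finite_iff_infinite] at hinf
  have htop : ∑' _ : Step Γ S ψ v, ENNReal.ofReal (‖v.state‖ ^ 2) ≠ ⊤ :=
    ENNReal.ne_top_of_tsum_ne_top
      (by rw [tsum_step_norm_sq d ψ]; exact ENNReal.ofReal_ne_top) v
  by_cases h0 : v.state = 0
  · have hb : v.bit = true := by
      by_contra hb
      exact hv ⟨h0, by simpa using hb⟩
    obtain ⟨x, -, hx⟩ := exists_unique_true_deriv d ψ
    obtain ⟨s, t, hst⟩ := exists_pair_ne (Step Γ S ψ v)
    obtain ⟨E, φ, ν⟩ := v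
    obtain rfl : E = Δ := s.env_eq d
    have hs := hx ⟨(φ, ν), s⟩ hb
    have ht := hx ⟨(φ, ν), t⟩ hb
    exact hst (eq_of_heq (Sigma.mk.inj (hs.trans ht.symm)).2)
  · refine htop (ENNReal.tsum_const_eq_top_of_ne_zero ?_)
    simpa using h0

/-- The discarded value has norm zero and costs nothing. Elsewhere finiteness is essential, since
`Nat.card` is 0 on an infinite type. -/
theorem tsum_step_norm_sq_eq_ensemble (d : Typing Γ S Δ) (ψ : Hilb Γ) (v : Value X) :
    ∑' _ : Step Γ S ψ v, ENNReal.ofReal (‖v.state‖ ^ 2) =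
      ENNReal.ofReal (ensemble Γ S ψ v * ‖v.state‖ ^ 2) := by
  by_cases hv : v.IsTrivial
  · simp [hv.1]
  · have := finite_step d ψ hv
    rw [ENNReal.tsum_const, ENNReal.ofReal_mul (Nat.cast_nonneg _), ensemble, if_neg hv,
      ENNReal.ofReal_natCast, ENat.card_eq_coe_natCard, ENat.toENNReal_coe]

theorem hasSum_ensemble (d : Typing Γ S Δ) (ψ : Hilb Γ) :
    HasSum (fun v : Value X => (ensemble Γ S ψ v : ℝ) * ‖v.state‖ ^ 2)
      ((denote d).1 (pure ψ)).trace.re := by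
  have h := tsum_step_norm_sq d ψ
  simp only [tsum_step_norm_sq_eq_ensemble d ψ] at h
  have hn : ∀ v : Value X, 0 ≤ (ensemble Γ S ψ v : ℝ) * ‖v.state‖ ^ 2 := fun v => by positivity
  have hpos : 0 ≤ ((denote d).1 (pure ψ)).trace.re :=
    PosSemidef.trace_re_nonneg ((Den.Regular.denote d).isCP.posSemidef (posSemidef_pure ψ))
  have hne : ∑' v : Value X, ENNReal.ofReal (ensemble Γ S ψ v * ‖v.state‖ ^ 2) ≠ ⊤ := by
    rw [h]; exact ENNReal.ofReal_ne_top
  have hs := ENNReal.hasSum_toReal hne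
  rw [← ENNReal.tsum_toReal_eq fun v => ENNReal.ofReal_ne_top, h, ENNReal.toReal_ofReal hpos] at hs
  simpa only [ENNReal.toReal_ofReal (hn _)] using hs

end Termination

end QCtrl

theorem mainTheorem5 {X : Type u} [DecidableEq X] {Γ Δ : Finset X} {S : QCtrl.Stmt X}
    (d : QCtrl.Typing Γ S Δ)
    (C : QCtrl.Superop (QCtrl.BasisIdx Γ) (QCtrl.BasisIdx Δ)) (F : QCtrl.Op Γ Δ)
    (hCF : QCtrl.denote d = (C, F))
    (ψ : QCtrl.Hilb Γ) (hψ : ‖ψ‖ ≤ 1) (hψ₀ : ψ ≠ 0) :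
    (∀ v : QCtrl.Value X, ¬ v.IsTrivial → Finite (QCtrl.Step Γ S ψ v)) ∧
    (Summable fun v : QCtrl.Value X =>
      (QCtrl.ensemble Γ S ψ v : ℝ) * (‖v.state‖ ^ 2 / ‖ψ‖ ^ 2)) ∧
    (QCtrl.probTerm Γ S ψ : ℂ) = (C (QCtrl.pure ψ)).trace / (QCtrl.pure ψ).trace := by
  have hC : (QCtrl.denote d).1 = C := congrArg Prod.fst hCF
  have hsum := (QCtrl.hasSum_ensemble d ψ).div_const (‖ψ‖ ^ 2)
  simp only [mul_div_assoc] at hsum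
  refine ⟨fun v hv => QCtrl.finite_step d ψ hv, hsum.summable, ?_⟩
  have hpos := ((QCtrl.Den.Regular.denote d).isCP.posSemidef
    (QCtrl.posSemidef_pure ψ)).trace_nonneg
  rw [QCtrl.probTerm, hsum.tsum_eq, QCtrl.trace_pure, Complex.ofReal_div, ← hC]
  congr 1
  -- Positivity of the output operator makes its trace real.
  exact Complex.ext rfl (Complex.le_def.1 hpos).2
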